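/- Let $N\ge 2$ be an integer and let $B,L\subset\mathbb Z$ be finite sets with $0\in B\cap L$ and $2\le \#B=\#L<N$ such that $(N,B,L)$ is a Hadamard triple, i.e. the matrix $$\Big(\tfrac1{\sqrt{\#B}}\,e^{2\pi i b\ell/N}\Big)_{b\in B,\ \ell\in L}$$ is unitary. For $a\in\mathbb Z$ put $\tau_a(x)=(x+a)/N$ for $x\in\mathbb R$. Let $\mu_{N,B}$ be the self-similar measure of $\{\tau_b\}_{b\in B}$, i.e. the unique Borel probability measure $\mu$ on $\mathbb R$ with $\mu=\frac1{\#B}\sum_{b\in B}\mu\circ\tau_b^{-1}$. Let $K(N,L)$ be the attractor of $\{\tau_\ell\}_{\ell\in L}$, i.e. the unique non-empty compact set $K\subset\mathbb R$ with $K=\bigcup_{\ell\in L}\tau_\ell(K)$; equivalently, $K(N,L)=\big\{\sum_{k\ge1}\ell_kN^{-k}:\ell_k\in L\big\}$. Put $m_B(x)=\frac1{\#B}\sum_{b\in B}e^{2\pi i bx}$. An $m_B$-cycle is a finite set $\{x_1,\dots,x_k\}\subset\mathbb R$, $k\ge1$, for which there are $\ell_1,\dots,\ell_k\in L$ with $\tau_{\ell_j}(x_j)=x_{j+1}$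 for $1\le j\le k-1$ and $\tau_{\ell_k}(x_k)=x_1$, and such that $|m_B(x_j)|=1$ for all $j$. Let $\Lambda\subset\mathbb R$ be the canonical spectrum of $\mu_{N,B}$, i.e. the smallest set that contains $-C$ for all $m_B$-cycles $C$ and satisfies $N\Lambda+L\subset\Lambda$. For a probability measure $\mu$ on $\mathbb R$ and a countable set $\Gamma\subset\mathbb R$, call $(\mu,\Gamma)$ a spectral pair if $\{e^{2\pi i\gamma x}:\gamma\in\Gamma\}$ is an orthonormal basis of $L^2(\mu)$. A real number $t$ is a spectral eigenvalue of a spectral pair $(\mu,\Gamma)$ if $(\mu,t\Gamma)$ is also a spectral pair. Let $d=\gcd(B)$, and for a positive integer $m$ write $\mathbb Z/m=\{k/m:k\in\mathbb Z\}\subset\mathbb R$. Then for every integer $q\ge2$ with $\gcd(q,N)=1$, $q$ is a spectral eigenvalue of $(\mu_{N,B},\Lambda)$ if and only if $$K(N,L)\cap\frac{\mathbb Z}{qd}=K(N,L)\cap\frac{\mathbb Z}{d}.$$ -/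

import Mathlib

open MeasureTheory Filter Topology
open scoped ENNReal

namespace CanonicalSpectrum

/-! ### Hadamard triples -/

/-- The matrix `(1/√#B · e^{2π i b ℓ / N})` with rows `b ∈ B` and columns `ℓ ∈ L`. -/
noncomputable def hadamardMatrix (N : ℕ) (B L : Finset ℤ) : Matrix B L ℂ :=
  Matrix.of fun b l =>
    (1 / (Real.sqrt (B.card : ℝ) : ℂ)) *
      Complex.exp (2 * Real.pi * Complex.I * ((b : ℤ) * (l : ℤ) / (N : ℂ)))

/-- `(N, B, L)` is a Hadamard triple in `ℝ`. -/
structure IsHadamardTriple (N : ℕ) (B L : Finset ℤ) : Prop where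
  two_le : 2 ≤ N
  card_eq : B.card = L.card
  two_le_card : 2 ≤ B.card
  /-- unitarity (both products are required since rows and columns are indexed differently) -/
  mul_conjTranspose : hadamardMatrix N B L * (hadamardMatrix N B L).conjTranspose = 1
  conjTranspose_mul : (hadamardMatrix N B L).conjTranspose * hadamardMatrix N B L = 1

/-- The contraction `τ_a(x) = (x + a) / N`. -/
noncomputable def tau (N : ℕ) (a : ℤ) (x : ℝ) : ℝ := (x + a) / N

/-! ### Self-similar sets -/

/-- The real number with `N`-adic coding `a`, i.e. `∑_{k ≥ 1} a_k N^{-k}` (digits indexed from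
`0` here). -/
noncomputable def coding (N : ℕ) (A : Finset ℤ) (a : ℕ → A) : ℝ :=
  ∑' k : ℕ, ((a k : ℤ) : ℝ) / (N : ℝ) ^ (k + 1)

/-- The self-similar set `K(N, A)`, the set of all sums `∑_{k ≥ 1} a_k N^{-k}` with `a_k ∈ A`.
By `isSelfSimilarSet_iff` below it is the unique non-empty compact `K` with
`K = ⋃_{a ∈ A} τ_a(K)`. -/
def attractor (N : ℕ) (A : Finset ℤ) : Set ℝ := Set.range (coding N A)

/-- `K` is a non-empty compact set invariant under the IFS `{τ_a : a ∈ A}`. -/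
structure IsSelfSimilarSet (N : ℕ) (A : Finset ℤ) (K : Set ℝ) : Prop where
  nonempty : K.Nonempty
  isCompact : IsCompact K
  invariant : K = ⋃ a ∈ A, tau N a '' K

/-! ### Self-similar measures -/

/-- `μ` is a Borel probability measure with `μ = (1/#B) ∑_{b ∈ B} μ ∘ τ_b⁻¹`. -/
structure IsSelfSimilarMeasure (N : ℕ) (B : Finset ℤ) (μ : Measure ℝ) : Prop where
  isProbabilityMeasure : IsProbabilityMeasure μ
  selfSimilar : μ = (B.card : ℝ≥0∞)⁻¹ • ∑ b ∈ B, μ.map (tau N b)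

/-- The self-similar measure `μ_{N,B}`: the measure with `IsSelfSimilarMeasure N B μ`, which
exists and is unique by `existsUnique_isSelfSimilarMeasure` below
(for `N ≥ 2` and `B` non-empty). -/
noncomputable def selfSimilarMeasure (N : ℕ) (B : Finset ℤ) : Measure ℝ :=
  Classical.epsilon (IsSelfSimilarMeasure N B)

/-! ### The canonical spectrum -/

/-- `m_B(x) = (1/#B) ∑_{b ∈ B} e^{2π i b x}`. -/
noncomputable def mask (B : Finset ℤ) (x : ℝ) : ℂ :=
  (1 / (B.card : ℂ)) * ∑ b ∈ B, Complex.exp (2 * Real.pi * Complex.I * b * x)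

/-- `C` is an `m_B`-cycle (extreme cycle) for the IFS `{τ_ℓ : ℓ ∈ L}`: it consists of
`x_0, …, x_k` with `τ_{ℓ_j}(x_j) = x_{j+1}` for suitable `ℓ_j ∈ L`
(indices modulo `k + 1`; addition in `Fin (k + 1)` is cyclic) and `|m_B(x_j)| = 1` for all `j`. -/
def IsExtremeCycle (N : ℕ) (B L : Finset ℤ) (C : Set ℝ) : Prop :=
  ∃ (k : ℕ) (x : Fin (k + 1) → ℝ) (l : Fin (k + 1) → ℤ),
    C = Set.range x ∧ (∀ j, l j ∈ L) ∧ (∀ j, tau N (l j) (x j) = x (j + 1)) ∧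
      ∀ j, ‖mask B (x j)‖ = 1

/-- The canonical spectrum: the smallest set `Λ` that contains `-C` for every `m_B`-cycle `C` and
satisfies `N Λ + L ⊆ Λ`. -/
def canonicalSpectrum (N : ℕ) (B L : Finset ℤ) : Set ℝ :=
  ⋂₀ {S : Set ℝ | (∀ C, IsExtremeCycle N B L C → ∀ x ∈ C, -x ∈ S) ∧
    ∀ s ∈ S, ∀ l ∈ L, (N : ℝ) * s + (l : ℝ) ∈ S}

/-! ### Spectral pairs and spectral eigenvalues -/

/-- `(μ, Λ)` is a spectral pair in `ℝ`: `μ` is a Borel probability measure, `Λ` is countable, and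
the exponentials `e_λ(x) = e^{2π i λ x}`, `λ ∈ Λ`, form an orthonormal basis of `L²(μ)`. -/
structure IsSpectralPair (μ : Measure ℝ) (Λ : Set ℝ) : Prop where
  isProbabilityMeasure : IsProbabilityMeasure μ
  countable : Λ.Countable
  exists_basis : ∃ e : HilbertBasis Λ ℂ (Lp ℂ 2 μ), ∀ l : Λ,
    (e l : ℝ → ℂ) =ᵐ[μ] fun x : ℝ => Complex.exp (2 * Real.pi * Complex.I * (l : ℝ) * x)

/-- `t` is a spectral eigenvalue of the spectral pair `(μ, Λ)`: both `(μ, Λ)` and `(μ, tΛ)` are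
spectral pairs. -/
def IsSpectralEigenvalue (μ : Measure ℝ) (Λ : Set ℝ) (t : ℝ) : Prop :=
  IsSpectralPair μ Λ ∧ IsSpectralPair μ ((fun x : ℝ => t * x) '' Λ)

/-- The set `ℤ/m = {k/m : k ∈ ℤ}` (used for `m ≠ 0`). -/
def intDiv (m : ℤ) : Set ℝ := Set.range fun k : ℤ => (k : ℝ) / (m : ℝ)

/-! ### The self-similar set and measure are well defined -/

section Existence

variable {N : ℕ} {A : Finset ℤ}

theorem exists_digit_bound (A : Finset ℤ) : ∃ M : ℝ, ∀ a ∈ A, |(a : ℝ)| ≤ M :=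
  ⟨∑ a ∈ A, |(a : ℝ)|, fun _ ha =>
    Finset.single_le_sum (f := fun a : ℤ => |(a : ℝ)|) (fun _ _ => abs_nonneg _) ha⟩

theorem coding_term_bound (hN : 2 ≤ N) {M : ℝ} (hM : ∀ a ∈ A, |(a : ℝ)| ≤ M) (a : ℕ → A) (k : ℕ) :
    ‖((a k : ℤ) : ℝ) / (N : ℝ) ^ (k + 1)‖ ≤ M * ((N : ℝ)⁻¹) ^ (k + 1) := by
  rw [norm_div, norm_pow, Real.norm_natCast, inv_pow, div_eq_mul_inv, Real.norm_eq_abs]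
  gcongr
  exact hM _ (a k).2

theorem summable_bound (hN : 2 ≤ N) (M : ℝ) :
    Summable fun k : ℕ => M * ((N : ℝ)⁻¹) ^ (k + 1) := by
  have h2 : (2 : ℝ) ≤ N := by exact_mod_cast hN
  have h : Summable fun k : ℕ => ((N : ℝ)⁻¹) ^ k :=
    summable_geometric_of_lt_one (by positivity) (inv_lt_one_of_one_lt₀ (by linarith))
  exact ((summable_nat_add_iff 1).2 h).mul_left M

theorem summable_coding (hN : 2 ≤ N) (a : ℕ → A) :
    Summable fun k : ℕ => ((a k : ℤ) : ℝ) / (N : ℝ) ^ (k + 1) := by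
  obtain ⟨M, hM⟩ := exists_digit_bound A
  exact Summable.of_norm_bounded (summable_bound hN M) (coding_term_bound hN hM a)

theorem continuous_coding (hN : 2 ≤ N) : Continuous (coding N A) := by
  obtain ⟨M, hM⟩ := exists_digit_bound A
  refine continuous_tsum (fun k => ?_) (summable_bound hN M)
    (fun k a => coding_term_bound hN hM a k)
  have : Continuous fun x : A => ((x : ℤ) : ℝ) := continuous_of_discreteTopology
  exact (this.comp (continuous_apply k)).div_const _

theorem coding_eq (hN : 2 ≤ N) (a : ℕ → A) :
    coding N A a = tau N (a 0) (coding N A fun k => a (k + 1)) := by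
  have hN0 : (N : ℝ) ≠ 0 := by positivity
  unfold coding tau
  rw [(summable_coding hN a).tsum_eq_zero_add, add_div, ← tsum_div_const, add_comm]
  congr 1
  · refine tsum_congr fun k => ?_
    field_simp
    ring
  · simp

theorem tendsto_inv_pow (hN : 2 ≤ N) (y : ℝ) :
    Tendsto (fun n : ℕ => y / (N : ℝ) ^ n) atTop (𝓝 0) := by
  have h2 : (2 : ℝ) ≤ N := by exact_mod_cast hN
  simpa [div_eq_mul_inv] using
    (tendsto_pow_atTop_nhds_zero_of_lt_one (r := ((N : ℝ)⁻¹)) (by positivity)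
      (inv_lt_one_of_one_lt₀ (by linarith))).const_mul y

theorem isSelfSimilarSet_attractor (hN : 2 ≤ N) (hA : A.Nonempty) :
    IsSelfSimilarSet N A (attractor N A) := by
  have : Nonempty A := hA.to_subtype
  refine ⟨Set.range_nonempty _, isCompact_range (continuous_coding hN), ?_⟩
  ext x
  simp only [Set.mem_iUnion, Set.mem_image, attractor]
  constructor
  · rintro ⟨a, rfl⟩
    exact ⟨a 0, (a 0).2, _, ⟨_, rfl⟩, (coding_eq hN a).symm⟩
  · rintro ⟨c, hc, _, ⟨a, rfl⟩, rfl⟩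
    refine ⟨fun k => Nat.casesOn k ⟨c, hc⟩ a, ?_⟩
    rw [coding_eq hN]
    rfl

/-- The self-similar set is the unique non-empty compact invariant set of the IFS. -/
theorem isSelfSimilarSet_iff (hN : 2 ≤ N) (hA : A.Nonempty) (K : Set ℝ) :
    IsSelfSimilarSet N A K ↔ K = attractor N A := by
  refine ⟨fun hK => ?_, fun h => h ▸ isSelfSimilarSet_attractor hN hA⟩
  have hN0 : (N : ℝ) ≠ 0 := by positivity
  have hsum : ∀ a : ℕ → A, Tendsto
      (fun n => ∑ k ∈ Finset.range n, ((a k : ℤ) : ℝ) / (N : ℝ) ^ (k + 1)) atTop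
      (𝓝 (coding N A a)) := fun a => (summable_coding hN a).hasSum.tendsto_sum_nat
  apply Set.Subset.antisymm
  · intro x hx
    have hstep : ∀ y : K, ∃ c : A, ∃ z : K, (y : ℝ) = tau N c z := by
      rintro ⟨y, hy⟩
      have hy' := hy
      rw [hK.invariant] at hy'
      simp only [Set.mem_iUnion, Set.mem_image] at hy'
      obtain ⟨c, hc, z, hz, rfl⟩ := hy'
      exact ⟨⟨c, hc⟩, ⟨z, hz⟩, rfl⟩
    choose c z hz using hstep
    let X : ℕ → K := fun n => z^[n] ⟨x, hx⟩
    have hX : ∀ n, (X n : ℝ) = tau N (c (X n)) (X (n + 1)) := by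
      intro n
      rw [hz (X n)]
      simp only [X, Function.iterate_succ_apply']
    have hx_eq : ∀ n, x = ∑ k ∈ Finset.range n, ((c (X k) : ℤ) : ℝ) / (N : ℝ) ^ (k + 1) +
        (X n : ℝ) / (N : ℝ) ^ n := by
      intro n
      induction n with
      | zero => simp [X]
      | succ n ih =>
        rw [Finset.sum_range_succ, ih, hX n]
        unfold tau
        field_simp
        ring
    obtain ⟨R, hR⟩ := hK.isCompact.isBounded.exists_norm_le
    have hlim0 : Tendsto (fun n => (X n : ℝ) / (N : ℝ) ^ n) atTop (𝓝 0) := by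
      refine squeeze_zero_norm (fun n => ?_) (tendsto_inv_pow hN R)
      rw [norm_div, norm_pow, Real.norm_natCast]
      gcongr
      exact hR _ (X n).2
    have hlim := (hsum fun k => c (X k)).add hlim0
    simp only [← hx_eq, add_zero] at hlim
    exact ⟨fun k => c (X k), tendsto_nhds_unique hlim tendsto_const_nhds⟩
  · rintro _ ⟨a, rfl⟩
    obtain ⟨y, hy⟩ := hK.nonempty
    have hmem : ∀ (n : ℕ) (a : ℕ → A),
        ∑ k ∈ Finset.range n, ((a k : ℤ) : ℝ) / (N : ℝ) ^ (k + 1) + y / (N : ℝ) ^ n ∈ K := by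
      intro n
      induction n with
      | zero => intro a; simpa using hy
      | succ n ih =>
        intro a
        rw [hK.invariant]
        simp only [Set.mem_iUnion, Set.mem_image]
        refine ⟨a 0, (a 0).2, _, ih fun k => a (k + 1), ?_⟩
        rw [Finset.sum_range_succ']
        unfold tau
        rw [add_div, add_div, Finset.sum_div]
        have h1 : ∀ k ∈ Finset.range n, ((a (k + 1) : ℤ) : ℝ) / (N : ℝ) ^ (k + 1) / N =
            ((a (k + 1) : ℤ) : ℝ) / (N : ℝ) ^ (k + 1 + 1) := fun k _ => by field_simp; ring
        rw [Finset.sum_congr rfl h1]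
        field_simp
        ring
    have hlim := (hsum a).add (tendsto_inv_pow hN y)
    rw [add_zero] at hlim
    exact hK.isCompact.isClosed.mem_of_tendsto hlim (Eventually.of_forall fun n => hmem n a)

theorem measurable_tau (b : ℤ) : Measurable (tau N b) := by
  unfold tau
  fun_prop

theorem charFun_selfSimilar {μ : Measure ℝ} (hμ : IsSelfSimilarMeasure N A μ) (t : ℝ) :
    charFun μ t = (A.card : ℂ)⁻¹ *
      ∑ b ∈ A, Complex.exp (t * b / N * Complex.I) * charFun μ (t / N) := by
  have := hμ.isProbabilityMeasure
  have hint : ∀ b ∈ A, Integrable (fun x : ℝ => Complex.exp (t * x * Complex.I))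
      (μ.map (tau N b)) := by
    intro b _
    have : IsProbabilityMeasure (μ.map (tau N b)) :=
      Measure.isProbabilityMeasure_map (measurable_tau b).aemeasurable
    refine Integrable.of_bound (C := 1) (by fun_prop) (Eventually.of_forall fun x => ?_)
    rw [← Complex.ofReal_mul, Complex.norm_exp_ofReal_mul_I]
  conv_lhs => rw [hμ.selfSimilar]
  rw [charFun_apply_real, integral_smul_measure, integral_finsetSum_measure hint]
  simp only [ENNReal.toReal_inv, ENNReal.toReal_natCast, Complex.real_smul]
  push_cast
  congr 1
  refine Finset.sum_congr rfl fun b _ => ?_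
  rw [integral_map (measurable_tau b).aemeasurable (by fun_prop), charFun_apply_real,
    ← integral_const_mul]
  refine integral_congr_ae (Eventually.of_forall fun x => ?_)
  simp only [tau]
  rw [← Complex.exp_add]
  congr 1
  push_cast
  ring

theorem selfSimilarMeasure_unique (hN : 2 ≤ N) (hA : A.Nonempty) {μ ν : Measure ℝ}
    (hμ : IsSelfSimilarMeasure N A μ) (hν : IsSelfSimilarMeasure N A ν) : μ = ν := by
  have := hμ.isProbabilityMeasure
  have := hν.isProbabilityMeasure
  have hcard : (A.card : ℝ) ≠ 0 := by exact_mod_cast hA.card_pos.ne'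
  have hstep : ∀ t, ‖charFun μ t - charFun ν t‖ ≤
      ‖charFun μ (t / N) - charFun ν (t / N)‖ := by
    intro t
    rw [charFun_selfSimilar hμ, charFun_selfSimilar hν, ← mul_sub, ← Finset.sum_sub_distrib,
      norm_mul, norm_inv, Complex.norm_natCast]
    calc (A.card : ℝ)⁻¹ * ‖∑ b ∈ A, (Complex.exp (t * b / N * Complex.I) * charFun μ (t / N) -
            Complex.exp (t * b / N * Complex.I) * charFun ν (t / N))‖
        ≤ (A.card : ℝ)⁻¹ * ∑ b ∈ A, ‖charFun μ (t / N) - charFun ν (t / N)‖ := by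
          gcongr
          refine norm_sum_le_of_le _ fun b _ => ?_
          rw [← mul_sub, norm_mul]
          have : ‖Complex.exp (t * b / N * Complex.I)‖ = 1 := by
            have := Complex.norm_exp_ofReal_mul_I (t * b / N)
            push_cast at this
            exact this
          rw [this, one_mul]
      _ = _ := by
          rw [Finset.sum_const, nsmul_eq_mul, inv_mul_cancel_left₀ hcard]
  have hiter : ∀ (n : ℕ) t, ‖charFun μ t - charFun ν t‖ ≤
      ‖charFun μ (t / (N : ℝ) ^ n) - charFun ν (t / (N : ℝ) ^ n)‖ := by
    intro n
    induction n with
    | zero => intro t; simp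
    | succ n ih =>
      intro t
      refine (ih t).trans ((hstep _).trans_eq ?_)
      rw [div_div, ← pow_succ]
  apply Measure.ext_of_charFun
  ext t
  have hc : Continuous fun s : ℝ => ‖charFun μ s - charFun ν s‖ :=
    ((continuous_charFun (μ := μ)).sub (continuous_charFun (μ := ν))).norm
  have hlim := (hc.tendsto 0).comp (tendsto_inv_pow hN t)
  simp only [charFun_zero, probReal_univ, sub_self, norm_zero] at hlim
  have h0 : ‖charFun μ t - charFun ν t‖ ≤ 0 := ge_of_tendsto' hlim fun n => hiter n t
  exact sub_eq_zero.1 (norm_le_zero_iff.1 h0)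

theorem exists_isSelfSimilarMeasure (hN : 2 ≤ N) (hA : A.Nonempty) :
    ∃ μ, IsSelfSimilarMeasure N A μ := by
  classical
  have : Nonempty A := hA.to_subtype
  have hc0 : (A.card : ℝ≥0∞) ≠ 0 := by exact_mod_cast hA.card_pos.ne'
  have hct : (A.card : ℝ≥0∞) ≠ ∞ := ENNReal.natCast_ne_top _
  -- the uniform measure on the digits and its infinite power
  let U : Measure A := (A.card : ℝ≥0∞)⁻¹ • ∑ b : A, Measure.dirac b
  have : IsProbabilityMeasure U := ⟨by simp [U, ENNReal.inv_mul_cancel hc0 hct]⟩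
  let P : Measure (ℕ → A) := Measure.infinitePi fun _ => U
  let cons : A → (ℕ → A) → (ℕ → A) := fun b a k => Nat.casesOn k b a
  have hcons : ∀ b, Measurable (cons b) := by
    intro b
    refine measurable_pi_lambda _ fun k => ?_
    cases k with
    | zero => exact measurable_const
    | succ k => exact measurable_pi_apply k
  have hP : (A.card : ℝ≥0∞)⁻¹ • ∑ b : A, P.map (cons b) = P := by
    refine Measure.eq_infinitePi _ fun s t ht => ?_
    let s' : Finset ℕ := s.preimage Nat.succ (Nat.succ_injective.injOn)
    have hpre : ∀ b, cons b ⁻¹' (Set.pi s t) =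
        if (0 ∈ s → b ∈ t 0) then Set.pi s' (fun k => t (k + 1)) else ∅ := by
      intro b
      ext a
      split_ifs with h
      · simp only [Set.mem_preimage, Set.mem_pi, Finset.mem_coe, s', Finset.mem_preimage]
        refine ⟨fun H k hk => H (k + 1) hk, fun H k hk => ?_⟩
        cases k with
        | zero => exact h hk
        | succ k => exact H k hk
      · simp only [Set.mem_preimage, Set.mem_pi, Finset.mem_coe, Set.mem_empty_iff_false,
          iff_false]
        intro H
        exact h fun h0 => H 0 h0
    have hval : ∀ b, P.map (cons b) (Set.pi s t) =
        (if (0 ∈ s → b ∈ t 0) then 1 else 0) * ∏ k ∈ s', U (t (k + 1)) := by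
      intro b
      rw [Measure.map_apply (hcons b) (.pi s.countable_toSet fun i _ => ht i), hpre]
      split_ifs
      · rw [one_mul, Measure.infinitePi_pi _ fun i _ => ht _]
      · simp
    have hU0 : U (t 0) = (A.card : ℝ≥0∞)⁻¹ * ∑ b : A, (if b ∈ t 0 then 1 else 0) := by
      simp [U, Set.indicator_apply]
    have hprod : ∏ k ∈ s, U (t k) =
        (if 0 ∈ s then U (t 0) else 1) * ∏ k ∈ s', U (t (k + 1)) := by
      have himg : s'.image Nat.succ = s.erase 0 := by
        ext k
        cases k <;> simp [s']
      have : ∏ k ∈ s', U (t (k + 1)) = ∏ k ∈ s.erase 0, U (t k) := by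
        rw [← himg, Finset.prod_image (Nat.succ_injective.injOn)]
      rw [this]
      split_ifs with h
      · exact (Finset.mul_prod_erase s (fun k => U (t k)) h).symm
      · rw [Finset.erase_eq_of_notMem h, one_mul]
    rw [hprod]
    simp only [Measure.smul_apply, Measure.finsetSum_apply, hval, smul_eq_mul]
    rw [← Finset.sum_mul, ← mul_assoc]
    congr 1
    split_ifs with h
    · simp [h, hU0]
    · simp [h, ENNReal.inv_mul_cancel hc0 hct]
  have hmeas : Measurable (coding N A) := (continuous_coding hN).measurable
  refine ⟨P.map (coding N A), Measure.isProbabilityMeasure_map hmeas.aemeasurable, ?_⟩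
  conv_lhs => rw [← hP]
  rw [← Finset.sum_coe_sort A]
  have hmap : (∑ b : A, P.map (cons b)).map (coding N A) =
      ∑ b : A, (P.map (cons b)).map (coding N A) := by
    ext S hS
    simp [Measure.map_apply hmeas hS]
  rw [Measure.map_smul, hmap]
  congr 1
  refine Finset.sum_congr rfl fun b _ => ?_
  rw [Measure.map_map hmeas (hcons b), Measure.map_map (measurable_tau _) hmeas]
  congr 1
  ext a
  simp only [Function.comp_apply]
  rw [coding_eq hN]
  rfl

/-- Existence and uniqueness of the self-similar measure. -/
theorem existsUnique_isSelfSimilarMeasure (hN : 2 ≤ N) (hA : A.Nonempty) :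
    ∃! μ, IsSelfSimilarMeasure N A μ :=
  (exists_isSelfSimilarMeasure hN hA).elim fun μ hμ =>
    ⟨μ, hμ, fun _ hν => selfSimilarMeasure_unique hN hA hν hμ⟩

theorem isSelfSimilarMeasure_selfSimilarMeasure (hN : 2 ≤ N) (hA : A.Nonempty) :
    IsSelfSimilarMeasure N A (selfSimilarMeasure N A) :=
  Classical.epsilon_spec (exists_isSelfSimilarMeasure hN hA)

end Existence

end CanonicalSpectrum

/-!
If `gcd(q, N) = 1` then `(N, B, qL)` is again a Hadamard triple, because `ζ ↦ ζ ^ q` acts on `N`-th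
roots of unity as a Galois automorphism. The canonical spectrum `Λ(L)` of a Hadamard triple is a
spectrum: `x ↦ ∑_{λ ∈ Λ(L)} |μ̂(x + λ)|²` is analytic, bounded by `1`, equal to `1` on extreme
cycles, and fixed by the transfer operator of the random walk `x ↦ τ_l(x)` with weights
`|m_B(τ_l x)|²`, so its minimum over a large interval is attained on an extreme cycle and it is
identically `1`. Hence `Λ(L)` and `Λ(qL)` are both spectra. As `qΛ(L) ⊆ Λ(qL)` and no spectrum
properly contains another one, `q` is a spectral eigenvalue if and only if `Λ(qL) = qΛ(L)`.

Since `|m_B(x)| = 1` exactly for `x ∈ ℤ/d`, extreme cycles are the cycles of `{τ_l}` inside `ℤ/d`,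
and `Λ(qL) = qΛ(L)` says that all cycles of `{τ_l : l ∈ L}` inside `ℤ/(qd)` lie in `ℤ/d`. Every
point of the finite set `K ∩ ℤ/(qd)` has a predecessor in it, and the successors of a point of `ℤ/d`
that lie in `ℤ/(qd)` lie in `ℤ/d`; so if `K ∩ ℤ/(qd)` were larger than `K ∩ ℤ/d`, the difference
would contain a cycle.
-/

open scoped Pointwise FourierTransform

namespace CanonicalSpectrum

section Lattice

theorem intDiv_eq_zmultiples (d : ℤ) : intDiv d = AddSubgroup.zmultiples (d : ℝ)⁻¹ := by
  ext x
  simp [intDiv, AddSubgroup.mem_zmultiples_iff, div_eq_mul_inv]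

theorem neg_mem_intDiv {d : ℤ} {x : ℝ} (hx : x ∈ intDiv d) : -x ∈ intDiv d := by
  rw [intDiv_eq_zmultiples] at *
  exact neg_mem hx

theorem add_mem_intDiv {d : ℤ} {x y : ℝ} (hx : x ∈ intDiv d) (hy : y ∈ intDiv d) :
    x + y ∈ intDiv d := by
  rw [intDiv_eq_zmultiples] at *
  exact add_mem hx hy

theorem intCast_mul_mem_intDiv {d : ℤ} {x : ℝ} (n : ℤ) (hx : x ∈ intDiv d) :
    n * x ∈ intDiv d := by
  rw [intDiv_eq_zmultiples] at *
  simpa using zsmul_mem hx n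

theorem mem_intDiv_iff {d : ℤ} (hd : d ≠ 0) {x : ℝ} : x ∈ intDiv d ↔ ∃ k : ℤ, d * x = k := by
  have hd' : (d : ℝ) ≠ 0 := Int.cast_ne_zero.2 hd
  simp only [intDiv, Set.mem_range, div_eq_iff hd', mul_comm x, eq_comm]

theorem intCast_mem_intDiv {d : ℤ} (hd : d ≠ 0) (n : ℤ) : (n : ℝ) ∈ intDiv d :=
  (mem_intDiv_iff hd).2 ⟨d * n, by push_cast; rfl⟩

theorem mem_intDiv_mul_iff {q d : ℤ} (hq : q ≠ 0) (hd : d ≠ 0) {x : ℝ} :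
    x ∈ intDiv (q * d) ↔ q * x ∈ intDiv d := by
  simp only [mem_intDiv_iff (mul_ne_zero hq hd), mem_intDiv_iff hd, Int.cast_mul, mul_assoc,
    mul_left_comm (d : ℝ)]

theorem intDiv_subset_mul {q d : ℤ} (hq : q ≠ 0) (hd : d ≠ 0) : intDiv d ⊆ intDiv (q * d) :=
  fun _ hx => (mem_intDiv_mul_iff hq hd).2 (intCast_mul_mem_intDiv q hx)

theorem forall_mul_eq_intCast_iff {B : Finset ℤ} (hd : B.gcd id ≠ 0) {x : ℝ} :
    (∀ b ∈ B, ∃ n : ℤ, b * x = n) ↔ x ∈ intDiv (B.gcd id) := by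
  rw [mem_intDiv_iff hd]
  constructor
  · intro h
    choose! n hn using h
    obtain ⟨g, hg⟩ := B.gcd_eq_sum_mul id
    refine ⟨∑ b ∈ B, g b * n b, ?_⟩
    rw [hg]
    push_cast
    rw [Finset.sum_mul]
    refine Finset.sum_congr rfl fun b hb => ?_
    rw [← hn b hb, id]
    ring
  · rintro ⟨k, hk⟩ b hb
    obtain ⟨c, hc⟩ : B.gcd id ∣ b := Finset.gcd_dvd hb
    exact ⟨c * k, by rw [hc]; push_cast; rw [← hk]; ring⟩

theorem gcd_ne_zero_of_one_lt_card {B : Finset ℤ} (hB : 1 < B.card) : B.gcd id ≠ 0 := by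
  obtain ⟨b, hb, hb0⟩ := Finset.exists_mem_ne hB 0
  exact fun h => hb0 (Finset.gcd_eq_zero_iff.1 h b hb)

end Lattice

section Mask

variable {B : Finset ℤ}

theorem fourierChar_eq_one_iff {x : ℝ} : 𝐞 x = 1 ↔ ∃ n : ℤ, x = n := by
  rw [Real.fourierChar_apply', Circle.exp_eq_one]
  refine exists_congr fun n => ?_
  rw [mul_comm, mul_left_inj' Real.two_pi_pos.ne']

theorem exp_two_pi_I_mul (x : ℝ) : Complex.exp (2 * Real.pi * Complex.I * x) = 𝐞 x := by
  rw [Real.fourierChar_apply]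
  push_cast
  ring_nf

theorem mask_eq_sum_fourierChar (B : Finset ℤ) (x : ℝ) :
    mask B x = (B.card : ℂ)⁻¹ * ∑ b ∈ B, (𝐞 (b * x) : ℂ) := by
  rw [mask, one_div]
  congr 1
  refine Finset.sum_congr rfl fun b _ => ?_
  rw [← exp_two_pi_I_mul]
  push_cast
  ring_nf

theorem mask_zero (hB : B.Nonempty) : mask B 0 = 1 := by
  simp [mask_eq_sum_fourierChar, hB.card_ne_zero]

theorem fourierChar_mul_eq_one_iff (hd : B.gcd id ≠ 0) {x : ℝ} :
    (∀ b ∈ B, 𝐞 (b * x) = 1) ↔ x ∈ intDiv (B.gcd id) := by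
  simp only [fourierChar_eq_one_iff, forall_mul_eq_intCast_iff hd]

theorem mask_add_of_mem_intDiv (hd : B.gcd id ≠ 0) (x : ℝ) {y : ℝ}
    (hy : y ∈ intDiv (B.gcd id)) : mask B (x + y) = mask B x := by
  simp only [mask_eq_sum_fourierChar]
  congr 1
  refine Finset.sum_congr rfl fun b hb => ?_
  rw [mul_add, AddChar.map_add_eq_mul, (fourierChar_mul_eq_one_iff hd).2 hy b hb, mul_one]

theorem norm_mask_eq_one_iff (hB0 : (0 : ℤ) ∈ B) (hd : B.gcd id ≠ 0) {x : ℝ} :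
    ‖mask B x‖ = 1 ↔ x ∈ intDiv (B.gcd id) := by
  have hcard : (B.card : ℝ) ≠ 0 := Nat.cast_ne_zero.2 (Finset.card_ne_zero_of_mem hB0)
  constructor
  · intro h
    rw [← fourierChar_mul_eq_one_iff hd]
    by_contra! ⟨b, hb, hne⟩
    have hne' : (𝐞 (b * x) : ℂ) ≠ 𝐞 ((0 : ℤ) * x) := by simpa [Circle.coe_eq_one] using hne
    have hlt := norm_sum_lt_of_strictConvexSpace (w := fun _ => (B.card : ℝ)⁻¹) (r := 1)
      (z := fun b : ℤ => (𝐞 (b * x) : ℂ)) (fun _ _ => by positivity)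
      (by simp [hcard]) hb hB0 hne' (inv_ne_zero hcard) (inv_ne_zero hcard)
      (fun _ _ => (Circle.norm_coe _).le)
    rw [← Finset.smul_sum, Complex.real_smul, Complex.ofReal_inv, Complex.ofReal_natCast,
      ← mask_eq_sum_fourierChar, h] at hlt
    exact lt_irrefl _ hlt
  · intro h
    rw [← zero_add x, mask_add_of_mem_intDiv hd 0 h, mask_zero ⟨0, hB0⟩, norm_one]

end Mask

section Hadamard

variable {N : ℕ} {B L : Finset ℤ}

theorem hadamardMatrix_apply (b : B) (l : L) :
    hadamardMatrix N B L b l = (√(B.card : ℝ) : ℂ)⁻¹ * 𝐞 ((b : ℝ) * (l : ℝ) / N) := by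
  rw [← exp_two_pi_I_mul]
  simp [hadamardMatrix]

theorem inv_sqrt_mul_inv_sqrt (n : ℕ) :
    (√(n : ℝ) : ℂ)⁻¹ * (√(n : ℝ) : ℂ)⁻¹ = (n : ℂ)⁻¹ := by
  rw [← mul_inv, ← Complex.ofReal_mul, Real.mul_self_sqrt n.cast_nonneg, Complex.ofReal_natCast]

theorem hadamardMatrix_conjTranspose_mul_apply (l l' : L) :
    ((hadamardMatrix N B L).conjTranspose * hadamardMatrix N B L) l l' =
      mask B (((l' : ℝ) - l) / N) := by
  rw [Matrix.mul_apply, mask_eq_sum_fourierChar, ← Finset.sum_coe_sort B, Finset.mul_sum]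
  refine Finset.sum_congr rfl fun b _ => ?_
  have hexp : (b : ℝ) * (((l' : ℝ) - l) / N) = -((b : ℝ) * l / N) + (b : ℝ) * l' / N := by ring
  rw [Matrix.conjTranspose_apply, hadamardMatrix_apply, hadamardMatrix_apply, hexp,
    AddChar.map_add_eq_mul, AddChar.map_neg_eq_inv, Circle.coe_mul, Circle.coe_inv_eq_conj,
    ← inv_sqrt_mul_inv_sqrt, star_mul', RCLike.star_def, map_inv₀, Complex.conj_ofReal]
  ring

theorem IsHadamardTriple.mask_sub_div (h : IsHadamardTriple N B L) {l l' : ℤ} (hl : l ∈ L)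
    (hl' : l' ∈ L) (hne : l ≠ l') : mask B (((l' : ℝ) - l) / N) = 0 := by
  rw [← hadamardMatrix_conjTranspose_mul_apply ⟨l, hl⟩ ⟨l', hl'⟩, h.conjTranspose_mul,
    Matrix.one_apply_ne (by simpa using hne)]

theorem IsHadamardTriple.gcd_ne_zero (h : IsHadamardTriple N B L) : B.gcd id ≠ 0 :=
  gcd_ne_zero_of_one_lt_card h.two_le_card

theorem IsHadamardTriple.nonempty (h : IsHadamardTriple N B L) : B.Nonempty :=
  Finset.card_pos.1 (by have := h.two_le_card; omega)

theorem IsHadamardTriple.ne_zero (h : IsHadamardTriple N B L) : N ≠ 0 := by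
  have := h.two_le
  omega

theorem IsHadamardTriple.not_dvd_sub (h : IsHadamardTriple N B L) {l l' : ℤ} (hl : l ∈ L)
    (hl' : l' ∈ L) (hne : l ≠ l') : ¬ (N : ℤ) ∣ l' - l := by
  rintro ⟨k, hk⟩
  have hk' : ((l' : ℝ) - l) / N = k := by
    rw [div_eq_iff (Nat.cast_ne_zero.2 h.ne_zero), mul_comm]
    exact_mod_cast hk
  have hmask := h.mask_sub_div hl hl' hne
  rw [hk', ← zero_add (k : ℝ), mask_add_of_mem_intDiv h.gcd_ne_zero 0
    (intCast_mem_intDiv h.gcd_ne_zero k), mask_zero h.nonempty] at hmask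
  exact one_ne_zero hmask

section

open Matrix

theorem dotProduct_star_eq_sum_norm_sq {n : Type*} [Fintype n] (v : n → ℂ) :
    v ⬝ᵥ star v = ((∑ i, ‖v i‖ ^ 2 : ℝ) : ℂ) := by
  simp [dotProduct, Complex.mul_conj']

theorem sum_norm_sq_vecMul {m n : Type*} [Fintype m] [Fintype n] [DecidableEq m]
    {U : Matrix m n ℂ} (hU : U * Uᴴ = 1) (v : m → ℂ) :
    ∑ j, ‖(v ᵥ* U) j‖ ^ 2 = ∑ i, ‖v i‖ ^ 2 := by
  have hdot : (v ᵥ* U) ⬝ᵥ star (v ᵥ* U) = v ⬝ᵥ star v := by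
    rw [star_vecMul, dotProduct_mulVec, vecMul_vecMul, hU, vecMul_one]
  simp only [dotProduct_star_eq_sum_norm_sq] at hdot
  exact_mod_cast hdot

end

theorem tau_eq_add (N : ℕ) (a : ℤ) (x : ℝ) : tau N a x = x / N + a / N := add_div x a N

/-- The quadrature mirror filter identity. -/
theorem IsHadamardTriple.sum_norm_mask_sq (h : IsHadamardTriple N B L) (x : ℝ) :
    ∑ l ∈ L, ‖mask B (tau N l x)‖ ^ 2 = 1 := by
  let v : B → ℂ := fun b => (√(B.card : ℝ) : ℂ)⁻¹ * 𝐞 ((b : ℝ) * (x / N))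
  have hv (l : L) : Matrix.vecMul v (hadamardMatrix N B L) l = mask B (tau N l x) := by
    rw [Matrix.vecMul, dotProduct, mask_eq_sum_fourierChar, ← Finset.sum_coe_sort B,
      Finset.mul_sum]
    refine Finset.sum_congr rfl fun b _ => ?_
    rw [hadamardMatrix_apply, tau_eq_add, mul_add, AddChar.map_add_eq_mul, Circle.coe_mul,
      ← inv_sqrt_mul_inv_sqrt, mul_div_assoc (b : ℝ) (l : ℝ)]
    ring
  have hnorm (b : B) : ‖v b‖ ^ 2 = (B.card : ℝ)⁻¹ := by
    simp [v, Circle.norm_coe]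
  rw [← Finset.sum_coe_sort L]
  simp_rw [← hv]
  rw [sum_norm_sq_vecMul h.mul_conjTranspose]
  simp [hnorm, h.nonempty.card_ne_zero]

end Hadamard

section Galois

/-- The powers `ζ` and `ζ ^ q` are roots of the same cyclotomic polynomial. -/
theorem sum_zpow_mul_eq_zero {K : Type*} [Field K] [CharZero K] {N : ℕ} (hN : 0 < N) {ζ : K}
    (hζ : IsPrimitiveRoot ζ N) {q : ℤ} (hqN : IsCoprime q (N : ℤ)) {ι : Type*} {s : Finset ι}
    {e : ι → ℤ} (h : ∑ i ∈ s, ζ ^ e i = 0) : ∑ i ∈ s, ζ ^ (q * e i) = 0 := by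
  have hN' : (N : ℤ) ≠ 0 := by exact_mod_cast hN.ne'
  have hmod (a : ℤ) : ((a % N).toNat : ℤ) = a % N := Int.toNat_of_nonneg (a.emod_nonneg hN')
  have hred (a : ℤ) : ζ ^ (a % N).toNat = ζ ^ a := by
    rw [← zpow_natCast, hmod]
    conv_rhs => rw [← Int.mul_ediv_add_emod a N]
    rw [zpow_add₀ (hζ.ne_zero hN.ne'), zpow_mul, zpow_natCast, hζ.pow_eq_one, one_zpow, one_mul]
  have hcop : (q % N).toNat.Coprime N := by
    rw [← Nat.isCoprime_iff_coprime, hmod]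
    simpa [Int.emod_def, sub_eq_add_neg, ← mul_neg] using hqN
  let P : Polynomial ℤ := ∑ i ∈ s, Polynomial.X ^ (e i % N).toNat
  have hP : minpoly ℤ ζ ∣ P :=
    minpoly.isIntegrallyClosed_dvd (hζ.isIntegral hN) (by simpa [P, hred] using h)
  rw [hζ.minpoly_eq_pow_coprime hcop] at hP
  have hroot : Polynomial.aeval (ζ ^ (q % N).toNat) P = 0 := by
    obtain ⟨Q, hQ⟩ := hP
    rw [hQ, map_mul, minpoly.aeval, zero_mul]
  have hterm (i : ι) : (ζ ^ (q % N).toNat) ^ (e i % N).toNat = ζ ^ (q * e i) := by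
    rw [hred q, ← zpow_natCast, ← zpow_mul, mul_comm, zpow_mul, zpow_natCast, hred, ← zpow_mul,
      mul_comm]
  simpa only [P, map_sum, map_pow, Polynomial.aeval_X, hterm] using hroot

theorem mask_intCast_mul_div_eq_zero {N : ℕ} (hN : 0 < N) {q : ℤ} (hqN : IsCoprime q (N : ℤ))
    {B : Finset ℤ} (hB : B.Nonempty) {n : ℤ} (h : mask B (n / N) = 0) :
    mask B ((q * n : ℤ) / N) = 0 := by
  have hζ := Complex.isPrimitiveRoot_exp N hN.ne'
  have hcard : (B.card : ℂ)⁻¹ ≠ 0 := inv_ne_zero (Nat.cast_ne_zero.2 hB.card_ne_zero)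
  have hpow (b n : ℤ) : (𝐞 (b * (n / N)) : ℂ) =
      Complex.exp (2 * Real.pi * Complex.I / N) ^ (n * b) := by
    rw [← Complex.exp_int_mul, ← exp_two_pi_I_mul]
    push_cast
    ring_nf
  simp only [mask_eq_sum_fourierChar, hpow, mul_eq_zero, hcard, false_or, mul_assoc q] at h ⊢
  exact sum_zpow_mul_eq_zero hN hζ hqN h

theorem IsHadamardTriple.image_mul {N : ℕ} {B L : Finset ℤ} (h : IsHadamardTriple N B L) {q : ℤ}
    (hq : q ≠ 0) (hqN : IsCoprime q (N : ℤ)) : IsHadamardTriple N B (L.image (q * ·)) := by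
  have hcard : B.card = (L.image (q * ·)).card := by
    rw [h.card_eq, Finset.card_image_of_injective _ (mul_right_injective₀ hq)]
  have hHH : (hadamardMatrix N B (L.image (q * ·))).conjTranspose *
      hadamardMatrix N B (L.image (q * ·)) = 1 := by
    ext ⟨m, hm⟩ ⟨m', hm'⟩
    obtain ⟨l, hl, rfl⟩ := Finset.mem_image.1 hm
    obtain ⟨l', hl', rfl⟩ := Finset.mem_image.1 hm'
    rw [hadamardMatrix_conjTranspose_mul_apply]
    rcases eq_or_ne l l' with rfl | hne
    · rw [sub_self, zero_div, mask_zero h.nonempty, Matrix.one_apply_eq]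
    · have hmask := mask_intCast_mul_div_eq_zero (Nat.pos_of_ne_zero h.ne_zero) hqN h.nonempty
        (n := l' - l) (by exact_mod_cast h.mask_sub_div hl hl' hne)
      rw [Matrix.one_apply_ne (by simpa [hq] using hne), ← hmask, mul_sub, Int.cast_sub]
  exact ⟨h.two_le, hcard, h.two_le_card,
    (Matrix.mul_eq_one_comm_of_card_eq _ _ _ (by simpa using hcard.symm)).1 hHH, hHH⟩

end Galois

section Cycles

theorem exists_cyclic_chain {α : Type*} {r : α → α → Prop} {Y : Set α} (hfin : Y.Finite)
    (hne : Y.Nonempty) (hr : ∀ x ∈ Y, ∃ y ∈ Y, r x y) :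
    ∃ (k : ℕ) (x : Fin (k + 1) → α), Set.range x ⊆ Y ∧ ∀ j, r (x j) (x (j + 1)) := by
  choose f hfY hf using fun x : Y => hr x x.2
  let g : Y → Y := fun x => ⟨f x, hfY x⟩
  have : Finite Y := hfin
  obtain ⟨y, hy⟩ := hne
  obtain ⟨m, n, hmn, heq⟩ := Finite.exists_ne_map_eq_of_infinite fun n => g^[n] ⟨y, hy⟩
  wlog hlt : m < n generalizing m n
  · exact this n m hmn.symm heq.symm (by omega)
  obtain ⟨k, rfl⟩ : ∃ k, n = m + (k + 1) := ⟨n - m - 1, by omega⟩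
  refine ⟨k, fun j => g^[m + j] ⟨y, hy⟩, ?_, fun j => ?_⟩
  · rintro _ ⟨j, rfl⟩
    exact Subtype.prop _
  · have hsucc : g^[m + (j + 1 : Fin (k + 1))] ⟨y, hy⟩ = g (g^[m + j] ⟨y, hy⟩) := by
      rw [← Function.iterate_succ_apply' g, Fin.val_add_one]
      split_ifs with hj
      · rw [add_zero, hj, Fin.val_last]
        exact heq
      · rfl
    simp only [hsucc]
    exact hf _

/-- A cycle of the iterated function system `{τ_l : l ∈ L}`: an `m_B`-cycle without the condition
on `|m_B|`. -/
def IsDigitCycle (N : ℕ) (L : Finset ℤ) (C : Set ℝ) : Prop :=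
  ∃ (k : ℕ) (x : Fin (k + 1) → ℝ), C = Set.range x ∧ ∀ j, ∃ l ∈ L, tau N l (x j) = x (j + 1)

variable {N : ℕ} {B L : Finset ℤ} {C : Set ℝ}

theorem isExtremeCycle_iff :
    IsExtremeCycle N B L C ↔ IsDigitCycle N L C ∧ ∀ x ∈ C, ‖mask B x‖ = 1 := by
  constructor
  · rintro ⟨k, x, l, rfl, hl, hx, hm⟩
    exact ⟨⟨k, x, rfl, fun j => ⟨l j, hl j, hx j⟩⟩, Set.forall_mem_range.2 hm⟩
  · rintro ⟨⟨k, x, rfl, hx⟩, hm⟩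
    choose l hl hx using hx
    exact ⟨k, x, l, rfl, hl, hx, Set.forall_mem_range.1 hm⟩

theorem isExtremeCycle_iff_subset_intDiv (hB0 : (0 : ℤ) ∈ B) (hd : B.gcd id ≠ 0) :
    IsExtremeCycle N B L C ↔ IsDigitCycle N L C ∧ C ⊆ intDiv (B.gcd id) := by
  simp only [isExtremeCycle_iff, norm_mask_eq_one_iff hB0 hd, Set.subset_def]

theorem IsDigitCycle.nonempty (hC : IsDigitCycle N L C) : C.Nonempty := by
  obtain ⟨k, x, rfl, -⟩ := hC
  exact Set.range_nonempty x

theorem IsDigitCycle.finite (hC : IsDigitCycle N L C) : C.Finite := by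
  obtain ⟨k, x, rfl, -⟩ := hC
  exact Set.finite_range x

theorem IsDigitCycle.exists_tau_mem (hC : IsDigitCycle N L C) {x : ℝ} (hx : x ∈ C) :
    ∃ l ∈ L, tau N l x ∈ C := by
  obtain ⟨k, y, rfl, hy⟩ := hC
  obtain ⟨j, rfl⟩ := hx
  obtain ⟨l, hl, hj⟩ := hy j
  exact ⟨l, hl, j + 1, hj.symm⟩

theorem IsDigitCycle.exists_tau_eq (hC : IsDigitCycle N L C) {x : ℝ} (hx : x ∈ C) :
    ∃ l ∈ L, ∃ y ∈ C, tau N l y = x := by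
  obtain ⟨k, y, rfl, hy⟩ := hC
  obtain ⟨j, rfl⟩ := hx
  obtain ⟨l, hl, hj⟩ := hy (j - 1)
  exact ⟨l, hl, y (j - 1), ⟨_, rfl⟩, by rw [hj, sub_add_cancel]⟩

theorem isDigitCycle_zero (hL0 : (0 : ℤ) ∈ L) : IsDigitCycle N L {0} :=
  ⟨0, fun _ => 0, by simp, fun _ => ⟨0, hL0, by simp [tau]⟩⟩

theorem isExtremeCycle_zero (hB : B.Nonempty) (hL0 : (0 : ℤ) ∈ L) : IsExtremeCycle N B L {0} :=
  isExtremeCycle_iff.2 ⟨isDigitCycle_zero hL0, by simp [mask_zero hB]⟩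

theorem exists_isDigitCycle_of_forward {Y : Set ℝ} (hfin : Y.Finite) (hne : Y.Nonempty)
    (hY : ∀ y ∈ Y, ∃ l ∈ L, tau N l y ∈ Y) : ∃ C ⊆ Y, IsDigitCycle N L C := by
  obtain ⟨k, x, hxY, hx⟩ := exists_cyclic_chain (r := fun y z => ∃ l ∈ L, tau N l y = z) hfin hne
    fun y hy => by
      obtain ⟨l, hl, hly⟩ := hY y hy
      exact ⟨_, hly, l, hl, rfl⟩
  exact ⟨_, hxY, k, x, rfl, hx⟩

theorem exists_isDigitCycle_of_backward {Y : Set ℝ} (hfin : Y.Finite) (hne : Y.Nonempty)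
    (hY : ∀ y ∈ Y, ∃ l ∈ L, ∃ z ∈ Y, tau N l z = y) : ∃ C ⊆ Y, IsDigitCycle N L C := by
  obtain ⟨k, x, hxY, hx⟩ := exists_cyclic_chain (r := fun y z => ∃ l ∈ L, tau N l z = y) hfin hne
    fun y hy => by
      obtain ⟨l, hl, z, hz, hzy⟩ := hY y hy
      exact ⟨z, hz, l, hl, hzy⟩
  refine ⟨_, hxY, k, fun j => x (-j), ((Equiv.neg _).surjective.range_comp x).symm, fun j => ?_⟩
  simpa using hx (-(j + 1))

theorem tau_mul (q a : ℤ) (x : ℝ) : tau N (q * a) (q * x) = q * tau N a x := by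
  simp only [tau]
  push_cast
  ring

theorem IsDigitCycle.smul (q : ℤ) (hC : IsDigitCycle N L C) :
    IsDigitCycle N (L.image (q * ·)) ((q : ℝ) • C) := by
  obtain ⟨k, x, rfl, hx⟩ := hC
  refine ⟨k, fun j => q * x j, by rw [Set.smul_set_range]; rfl, fun j => ?_⟩
  obtain ⟨l, hl, hj⟩ := hx j
  exact ⟨q * l, Finset.mem_image_of_mem _ hl, by rw [tau_mul, hj]⟩

theorem IsDigitCycle.exists_eq_smul {q : ℤ} (hq : q ≠ 0)
    (hC : IsDigitCycle N (L.image (q * ·)) C) : ∃ D, IsDigitCycle N L D ∧ C = (q : ℝ) • D := by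
  have hq' : (q : ℝ) ≠ 0 := Int.cast_ne_zero.2 hq
  obtain ⟨k, x, rfl, hx⟩ := hC
  refine ⟨_, ⟨k, fun j => (q : ℝ)⁻¹ * x j, rfl, fun j => ?_⟩, ?_⟩
  · obtain ⟨_, hql, hj⟩ := hx j
    obtain ⟨l, hl, rfl⟩ := Finset.mem_image.1 hql
    refine ⟨l, hl, ?_⟩
    dsimp only
    rw [← hj, eq_inv_mul_iff_mul_eq₀ hq', ← tau_mul, mul_inv_cancel_left₀ hq']
  · simp [Set.smul_set_range, hq']

end Cycles

section Attractor

variable {N : ℕ} {A : Finset ℤ}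

theorem tau_mem_attractor (hN : 2 ≤ N) {a : ℤ} (ha : a ∈ A) {x : ℝ} (hx : x ∈ attractor N A) :
    tau N a x ∈ attractor N A := by
  rw [(isSelfSimilarSet_attractor hN ⟨a, ha⟩).invariant]
  exact Set.mem_biUnion ha (Set.mem_image_of_mem _ hx)

theorem exists_tau_eq_of_mem_attractor (hN : 2 ≤ N) {x : ℝ} (hx : x ∈ attractor N A) :
    ∃ a ∈ A, ∃ y ∈ attractor N A, tau N a y = x := by
  obtain ⟨a, rfl⟩ := hx
  exact ⟨a 0, (a 0).2, _, ⟨_, rfl⟩, (coding_eq hN a).symm⟩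

theorem isCompact_attractor (hN : 2 ≤ N) : IsCompact (attractor N A) :=
  isCompact_range (continuous_coding hN)

theorem infDist_tau_attractor_le (hN : 2 ≤ N) {a : ℤ} (ha : a ∈ A) (x : ℝ) :
    Metric.infDist (tau N a x) (attractor N A) ≤ Metric.infDist x (attractor N A) / N := by
  have hK := isSelfSimilarSet_attractor hN ⟨a, ha⟩
  obtain ⟨y, hy, hxy⟩ := hK.isCompact.exists_infDist_eq_dist hK.nonempty x
  refine (Metric.infDist_le_dist_of_mem (tau_mem_attractor hN ha hy)).trans_eq ?_
  rw [hxy, Real.dist_eq, Real.dist_eq, tau, tau, ← sub_div, add_sub_add_right_eq_sub, abs_div,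
    Nat.abs_cast]

/-- Iterating backwards `n` times shows that `Y` lies within `O(N⁻ⁿ)` of the attractor. -/
theorem subset_attractor (hN : 2 ≤ N) {Y : Set ℝ} (hY : Bornology.IsBounded Y)
    (hstep : ∀ y ∈ Y, ∃ a ∈ A, ∃ z ∈ Y, tau N a z = y) : Y ⊆ attractor N A := by
  intro y hy
  obtain ⟨a, ha, -⟩ := hstep y hy
  have hK := isSelfSimilarSet_attractor hN ⟨a, ha⟩
  obtain ⟨x₀, hx₀⟩ := hK.nonempty
  obtain ⟨R, hR⟩ := hY.subset_closedBall x₀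
  have hdist (n : ℕ) : ∀ y ∈ Y, Metric.infDist y (attractor N A) ≤ R / N ^ n := by
    induction n with
    | zero =>
      intro y hy
      simpa using (Metric.infDist_le_dist_of_mem hx₀).trans (hR hy)
    | succ n ih =>
      intro y hy
      obtain ⟨a, ha, z, hz, rfl⟩ := hstep y hy
      refine (infDist_tau_attractor_le hN ha z).trans ?_
      rw [pow_succ, ← div_div]
      gcongr
      exact ih z hz
  rw [hK.isCompact.isClosed.mem_iff_infDist_zero hK.nonempty]
  exact le_antisymm (ge_of_tendsto' (tendsto_inv_pow hN R) fun n => hdist n y hy)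
    Metric.infDist_nonneg

theorem IsDigitCycle.subset_attractor (hN : 2 ≤ N) {C : Set ℝ} (hC : IsDigitCycle N A C) :
    C ⊆ attractor N A :=
  CanonicalSpectrum.subset_attractor hN hC.finite.isBounded fun _ => hC.exists_tau_eq

theorem finite_inter_intDiv {K : Set ℝ} (hK : Bornology.IsBounded K) (d : ℤ) :
    (K ∩ intDiv d).Finite := by
  rw [intDiv_eq_zmultiples]
  exact Metric.finite_isBounded_inter_isClosed
    (SetLike.isDiscrete_iff_discreteTopology.2 inferInstance) hK
    (AddSubgroup.isClosed_of_discrete)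

end Attractor

section Spectrum

variable {N : ℕ} {B L : Finset ℤ}

theorem neg_mem_canonicalSpectrum {C : Set ℝ} (hC : IsExtremeCycle N B L C) {x : ℝ} (hx : x ∈ C) :
    -x ∈ canonicalSpectrum N B L := fun _ hS => hS.1 C hC x hx

theorem mul_add_mem_canonicalSpectrum {s : ℝ} (hs : s ∈ canonicalSpectrum N B L) {l : ℤ}
    (hl : l ∈ L) : (N : ℝ) * s + l ∈ canonicalSpectrum N B L :=
  fun S hS => hS.2 s (hs S hS) l hl

theorem canonicalSpectrum_subset {S : Set ℝ}
    (hcycle : ∀ C, IsExtremeCycle N B L C → ∀ x ∈ C, -x ∈ S)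
    (hmul_add : ∀ s ∈ S, ∀ l ∈ L, (N : ℝ) * s + l ∈ S) : canonicalSpectrum N B L ⊆ S :=
  Set.sInter_subset_of_mem ⟨hcycle, hmul_add⟩

theorem exists_mul_add_eq_of_mem_canonicalSpectrum (hN : N ≠ 0) {s : ℝ}
    (hs : s ∈ canonicalSpectrum N B L) :
    ∃ u ∈ canonicalSpectrum N B L, ∃ l ∈ L, (N : ℝ) * u + l = s := by
  suffices h : canonicalSpectrum N B L ⊆ {s | s ∈ canonicalSpectrum N B L ∧
      ∃ u ∈ canonicalSpectrum N B L, ∃ l ∈ L, (N : ℝ) * u + l = s} from (h hs).2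
  refine canonicalSpectrum_subset (fun C hC x hx => ⟨neg_mem_canonicalSpectrum hC hx, ?_⟩)
    fun s hs l hl => ⟨mul_add_mem_canonicalSpectrum hs.1 hl, s, hs.1, l, hl, rfl⟩
  obtain ⟨l, hl, hlx⟩ := (isExtremeCycle_iff.1 hC).1.exists_tau_mem hx
  refine ⟨_, neg_mem_canonicalSpectrum hC hlx, l, hl, ?_⟩
  rw [tau]
  field_simp
  ring

theorem canonicalSpectrum_subset_intDiv (hB0 : (0 : ℤ) ∈ B) (hd : B.gcd id ≠ 0) :
    canonicalSpectrum N B L ⊆ intDiv (B.gcd id) :=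
  canonicalSpectrum_subset
    (fun _ hC _ hx => neg_mem_intDiv (((isExtremeCycle_iff_subset_intDiv hB0 hd).1 hC).2 hx))
    fun _ hs l _ => add_mem_intDiv (by simpa using intCast_mul_mem_intDiv N hs)
      (intCast_mem_intDiv hd l)

end Spectrum

section Scaling

variable {N : ℕ} {B L : Finset ℤ} {q : ℤ}

theorem smul_canonicalSpectrum_subset (hB0 : (0 : ℤ) ∈ B) (hd : B.gcd id ≠ 0) :
    (q : ℝ) • canonicalSpectrum N B L ⊆ canonicalSpectrum N B (L.image (q * ·)) := by
  rintro _ ⟨s, hs, rfl⟩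
  refine canonicalSpectrum_subset
    (S := {s | (q : ℝ) • s ∈ canonicalSpectrum N B (L.image (q * ·))})
    (fun C hC x hx => ?_) (fun s hs l hl => ?_) hs
  · rw [isExtremeCycle_iff_subset_intDiv hB0 hd] at hC
    have hqC : IsExtremeCycle N B (L.image (q * ·)) ((q : ℝ) • C) :=
      (isExtremeCycle_iff_subset_intDiv hB0 hd).2 ⟨hC.1.smul q, Set.smul_set_subset_iff.2
        fun y hy => intCast_mul_mem_intDiv q (hC.2 hy)⟩
    simpa using neg_mem_canonicalSpectrum hqC (Set.smul_mem_smul_set hx)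
  · have := mul_add_mem_canonicalSpectrum hs (Finset.mem_image_of_mem (q * ·) hl)
    simpa [mul_add, mul_left_comm] using this

theorem canonicalSpectrum_image_mul_subset (hN : 2 ≤ N) (hB0 : (0 : ℤ) ∈ B) (hd : B.gcd id ≠ 0)
    (hq : q ≠ 0) (hK : attractor N L ∩ intDiv (q * B.gcd id) ⊆ intDiv (B.gcd id)) :
    canonicalSpectrum N B (L.image (q * ·)) ⊆ (q : ℝ) • canonicalSpectrum N B L := by
  refine canonicalSpectrum_subset (fun C hC x hx => ?_) ?_
  · rw [isExtremeCycle_iff_subset_intDiv hB0 hd] at hC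
    obtain ⟨D, hD, rfl⟩ := hC.1.exists_eq_smul hq
    have hDd : D ⊆ intDiv (B.gcd id) := fun y hy => hK ⟨hD.subset_attractor hN hy,
      (mem_intDiv_mul_iff hq hd).2 (hC.2 (Set.smul_mem_smul_set hy))⟩
    obtain ⟨y, hy, rfl⟩ := hx
    have := neg_mem_canonicalSpectrum ((isExtremeCycle_iff_subset_intDiv hB0 hd).2 ⟨hD, hDd⟩) hy
    exact ⟨-y, this, by simp⟩
  · rintro _ ⟨s, hs, rfl⟩ _ hql
    obtain ⟨l, hl, rfl⟩ := Finset.mem_image.1 hql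
    exact ⟨_, mul_add_mem_canonicalSpectrum hs hl, by push_cast [smul_eq_mul]; ring⟩

theorem mem_intDiv_of_tau_mem_intDiv {d l : ℤ} (hd : d ≠ 0) (hN : N ≠ 0) {x : ℝ}
    (hx : tau N l x ∈ intDiv d) : x ∈ intDiv d := by
  have hx' : x = (N : ℤ) * tau N l x + (-l : ℤ) := by
    rw [tau]
    push_cast
    field_simp
    ring
  rw [hx']
  exact add_mem_intDiv (intCast_mul_mem_intDiv _ hx) (intCast_mem_intDiv hd _)

theorem tau_mem_intDiv {d l : ℤ} (hd : d ≠ 0) (hN : N ≠ 0) (hq : q ≠ 0)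
    (hqN : IsCoprime q (N : ℤ)) {x : ℝ} (hx : x ∈ intDiv d) (hqx : tau N l x ∈ intDiv (q * d)) :
    tau N l x ∈ intDiv d := by
  obtain ⟨u, v, huv⟩ := hqN
  have huv' : (u * q + v * N : ℝ) = 1 := by exact_mod_cast huv
  have hNx : (N : ℝ) * tau N l x ∈ intDiv d := by
    rw [tau, mul_div_cancel₀ _ (Nat.cast_ne_zero.2 hN)]
    exact add_mem_intDiv hx (intCast_mem_intDiv hd l)
  have hcomb : tau N l x = u * (q * tau N l x) + v * (N * tau N l x) := by
    linear_combination (-tau N l x) * huv'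
  rw [hcomb]
  exact add_mem_intDiv (intCast_mul_mem_intDiv u ((mem_intDiv_mul_iff hq hd).1 hqx))
    (intCast_mul_mem_intDiv v hNx)

theorem attractor_inter_intDiv_subset (hN : 2 ≤ N) (hB0 : (0 : ℤ) ∈ B) (hd : B.gcd id ≠ 0)
    (hq : q ≠ 0) (hqN : IsCoprime q (N : ℤ))
    (hΛ : canonicalSpectrum N B (L.image (q * ·)) ⊆ (q : ℝ) • canonicalSpectrum N B L) :
    attractor N L ∩ intDiv (q * B.gcd id) ⊆ intDiv (B.gcd id) := by
  have hN' : N ≠ 0 := by omega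
  let Y := (attractor N L ∩ intDiv (q * B.gcd id)) \ intDiv (B.gcd id)
  have hYfin : Y.Finite := (finite_inter_intDiv (isCompact_attractor hN).isBounded _).sdiff
  have hYpred : ∀ y ∈ Y, ∃ l ∈ L, ∃ z ∈ Y, tau N l z = y := by
    rintro y ⟨⟨hyK, hyq⟩, hyd⟩
    obtain ⟨l, hl, z, hzK, rfl⟩ := exists_tau_eq_of_mem_attractor hN hyK
    exact ⟨l, hl, z, ⟨⟨hzK, mem_intDiv_of_tau_mem_intDiv (mul_ne_zero hq hd) hN' hyq⟩,
      fun hz => hyd (tau_mem_intDiv hd hN' hq hqN hz hyq)⟩, rfl⟩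
  rw [← Set.sdiff_eq_empty, Set.eq_empty_iff_forall_notMem]
  by_contra! hYne
  obtain ⟨C, hCY, hC⟩ := exists_isDigitCycle_of_backward hYfin hYne hYpred
  have hqC : IsExtremeCycle N B (L.image (q * ·)) ((q : ℝ) • C) :=
    (isExtremeCycle_iff_subset_intDiv hB0 hd).2 ⟨hC.smul q, Set.smul_set_subset_iff.2
      fun y hy => (mem_intDiv_mul_iff hq hd).1 (hCY hy).1.2⟩
  obtain ⟨x, hx⟩ := hC.nonempty
  obtain ⟨s, hs, hsx⟩ := hΛ (neg_mem_canonicalSpectrum hqC (Set.smul_mem_smul_set hx))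
  have hxs : s = -x := by simpa [← mul_neg, hq] using hsx
  refine (hCY hx).2 ?_
  simpa [hxs] using neg_mem_intDiv (canonicalSpectrum_subset_intDiv hB0 hd hs)

theorem canonicalSpectrum_image_mul_eq_iff (hN : 2 ≤ N) (hB0 : (0 : ℤ) ∈ B) (hd : B.gcd id ≠ 0)
    (hq : q ≠ 0) (hqN : IsCoprime q (N : ℤ)) :
    canonicalSpectrum N B (L.image (q * ·)) = (q : ℝ) • canonicalSpectrum N B L ↔
      attractor N L ∩ intDiv (q * B.gcd id) = attractor N L ∩ intDiv (B.gcd id) := by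
  constructor
  · intro h
    exact (Set.subset_inter Set.inter_subset_left
      (attractor_inter_intDiv_subset hN hB0 hd hq hqN h.subset)).antisymm
      (Set.inter_subset_inter_right _ (intDiv_subset_mul hq hd))
  · intro h
    exact (canonicalSpectrum_image_mul_subset hN hB0 hd hq
      (h.subset.trans Set.inter_subset_right)).antisymm (smul_canonicalSpectrum_subset hB0 hd)

end Scaling

section RandomWalk

theorem exists_forall_transGen_self {α : Type*} {r : α → α → Prop} {E : Set α} (hfin : E.Finite)
    (hne : E.Nonempty) (hserial : ∀ x ∈ E, ∃ y, r x y) (hclosed : ∀ x ∈ E, ∀ y, r x y → y ∈ E) :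
    ∃ Y ⊆ E, Y.Nonempty ∧ (∀ x ∈ Y, ∀ y, r x y → y ∈ Y) ∧ ∀ x ∈ Y, Relation.TransGen r x x := by
  obtain ⟨Y, ⟨hYE, hYne, hY⟩, hmin⟩ := (hfin.finite_subsets.subset fun Y hY => hY.1 :
    {Y | Y ⊆ E ∧ Y.Nonempty ∧ ∀ x ∈ Y, ∀ y, r x y → y ∈ Y}.Finite).exists_minimal
      ⟨E, subset_rfl, hne, hclosed⟩
  refine ⟨Y, hYE, hYne, hY, fun x hx => ?_⟩
  have hreach : {y | Relation.TransGen r x y} ⊆ Y := by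
    intro y hy
    induction hy with
    | single hxy => exact hY _ hx _ hxy
    | tail _ hyz hy => exact hY _ hy _ hyz
  obtain ⟨y, hxy⟩ := hserial x (hYE hx)
  exact hmin ⟨hreach.trans hYE, ⟨y, .single hxy⟩, fun _ hu _ => .tail hu⟩ hreach hx

/-- One step of the random walk `x ↦ τ_l(x)`, `l ∈ L`, with transition probabilities
`|m_B(τ_l x)|²`. -/
def MaskStep (N : ℕ) (B L : Finset ℤ) (x y : ℝ) : Prop :=
  ∃ l ∈ L, mask B (tau N l x) ≠ 0 ∧ tau N l x = y

variable {N : ℕ} {B L : Finset ℤ}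

theorem IsHadamardTriple.exists_maskStep (h : IsHadamardTriple N B L) (x : ℝ) :
    ∃ y, MaskStep N B L x y := by
  obtain ⟨l, hl, hm⟩ := Finset.exists_ne_zero_of_sum_ne_zero
    ((h.sum_norm_mask_sq x).trans_ne one_ne_zero)
  exact ⟨_, l, hl, by simpa using hm, rfl⟩

theorem exists_pow_mul_eq_of_transGen (hN : N ≠ 0) {x y : ℝ}
    (h : Relation.TransGen (MaskStep N B L) x y) :
    ∃ (k : ℕ) (c : ℤ), (N : ℝ) ^ (k + 1) * y = x + c := by
  have hN' : (N : ℝ) ≠ 0 := Nat.cast_ne_zero.2 hN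
  have hstep {u v : ℝ} : MaskStep N B L u v → ∃ l : ℤ, (N : ℝ) * v = u + l := by
    rintro ⟨l, -, -, rfl⟩
    exact ⟨l, mul_div_cancel₀ _ hN'⟩
  induction h with
  | single hxy =>
    obtain ⟨l, hl⟩ := hstep hxy
    exact ⟨0, l, by simpa using hl⟩
  | tail _ hyz ih =>
    obtain ⟨l, hl⟩ := hstep hyz
    obtain ⟨k, c, hc⟩ := ih
    refine ⟨k + 1, c + N ^ (k + 1) * l, ?_⟩
    rw [pow_succ, mul_assoc, hl, mul_add, hc]
    push_cast
    ring

theorem exists_isCoprime_mul_eq_of_transGen_self (hN : N ≠ 0) {x : ℝ}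
    (h : Relation.TransGen (MaskStep N B L) x x) :
    ∃ m c : ℤ, IsCoprime m (N : ℤ) ∧ m * x = c := by
  obtain ⟨k, c, hc⟩ := exists_pow_mul_eq_of_transGen hN h
  refine ⟨N ^ (k + 1) - 1, c, ⟨-1, N ^ k, by ring⟩, ?_⟩
  push_cast
  linear_combination hc

theorem dvd_sub_of_isCoprime_mul_tau (hN : N ≠ 0) {x : ℝ} {l l' m m' c c' : ℤ}
    (hm : IsCoprime m (N : ℤ)) (hm' : IsCoprime m' (N : ℤ)) (hc : m * tau N l x = c)
    (hc' : m' * tau N l' x = c') : (N : ℤ) ∣ l' - l := by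
  have hN' : (N : ℝ) ≠ 0 := Nat.cast_ne_zero.2 hN
  have heq : m * m' * (l' - l) = N * (m * c' - m' * c) := by
    have : (m * m' * (l' - l) : ℝ) = N * (m * c' - m' * c) := by
      rw [← hc, ← hc', tau, tau]
      field_simp
      ring
    exact_mod_cast this
  exact (hm.mul_left hm').symm.dvd_of_dvd_mul_left ⟨_, heq⟩

theorem IsHadamardTriple.norm_mask_eq_one_of_unique (h : IsHadamardTriple N B L) {x : ℝ} {l : ℤ}
    (hl : l ∈ L) (huniq : ∀ l' ∈ L, mask B (tau N l' x) ≠ 0 → l' = l) :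
    ‖mask B (tau N l x)‖ = 1 := by
  have hsum := h.sum_norm_mask_sq x
  rw [Finset.sum_eq_single_of_mem l hl fun l' hl' hne => by
    simpa using not_imp_comm.1 (huniq l' hl') hne] at hsum
  exact (pow_eq_one_iff_of_nonneg (norm_nonneg _) two_ne_zero).1 hsum

/-- In a minimal closed set every point is recurrent, hence rational with denominator prime to `N`.
Two points `τ_l x ≠ τ_l' x` cannot both be of this kind, so the walk is deterministic there. -/
theorem IsHadamardTriple.exists_isExtremeCycle_subset (h : IsHadamardTriple N B L) {E : Set ℝ}
    (hfin : E.Finite) (hne : E.Nonempty) (hE : ∀ x ∈ E, ∀ y, MaskStep N B L x y → y ∈ E) :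
    ∃ C ⊆ E, IsExtremeCycle N B L C := by
  obtain ⟨Y, hYE, ⟨y, hy⟩, hY, hrec⟩ :=
    exists_forall_transGen_self hfin hne (fun x _ => h.exists_maskStep x) hE
  have hnext : ∀ x ∈ Y, ∃ l ∈ L, tau N l x ∈ Y ∧ ‖mask B (tau N l x)‖ = 1 := by
    intro x hx
    obtain ⟨_, l, hl, hm, rfl⟩ := h.exists_maskStep x
    have hlY := hY x hx _ ⟨l, hl, hm, rfl⟩
    refine ⟨l, hl, hlY, h.norm_mask_eq_one_of_unique hl fun l' hl' hm' => ?_⟩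
    by_contra hll'
    obtain ⟨_, _, hcop, hc⟩ := exists_isCoprime_mul_eq_of_transGen_self h.ne_zero (hrec _ hlY)
    obtain ⟨_, _, hcop', hc'⟩ := exists_isCoprime_mul_eq_of_transGen_self h.ne_zero
      (hrec _ (hY x hx _ ⟨l', hl', hm', rfl⟩))
    exact h.not_dvd_sub hl' hl hll' (dvd_sub_of_isCoprime_mul_tau h.ne_zero hcop' hcop hc' hc)
  obtain ⟨l, -, hlY, hm⟩ := hnext y hy
  obtain ⟨C, hCY, hC⟩ := exists_isDigitCycle_of_forward (L := L) (N := N)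
    (Y := {x ∈ Y | ‖mask B x‖ = 1}) ((hfin.subset hYE).sep _) ⟨_, hlY, hm⟩ fun x hx => hnext x hx.1
  exact ⟨C, fun x hx => hYE (hCY hx).1, isExtremeCycle_iff.2 ⟨hC, fun x hx => (hCY hx).2⟩⟩

end RandomWalk

section Fourier

theorem conj_fourierChar (x : ℝ) : (starRingEnd ℂ) (𝐞 x : ℂ) = 𝐞 (-x) := by
  rw [AddChar.map_neg_eq_inv, Circle.coe_inv_eq_conj]

/-- The Fourier–Stieltjes transform `t ↦ ∫ e^{2π i t x} dμ(x)`, that is Mathlib's `charFun` in the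
normalization in which frequencies are multiplied by `2π`. -/
noncomputable def fourierStieltjes (μ : Measure ℝ) (t : ℝ) : ℂ := ∫ x, (𝐞 (t * x) : ℂ) ∂μ

theorem fourierStieltjes_eq_charFun (μ : Measure ℝ) (t : ℝ) :
    fourierStieltjes μ t = charFun μ (2 * Real.pi * t) := by
  simp only [fourierStieltjes, charFun_apply_real, Real.fourierChar_apply]
  push_cast
  simp only [mul_assoc]

theorem fourierStieltjes_zero (μ : Measure ℝ) [IsProbabilityMeasure μ] :
    fourierStieltjes μ 0 = 1 := by
  simp [fourierStieltjes]

theorem fourierStieltjes_neg (μ : Measure ℝ) (t : ℝ) :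
    fourierStieltjes μ (-t) = (starRingEnd ℂ) (fourierStieltjes μ t) := by
  rw [fourierStieltjes_eq_charFun, fourierStieltjes_eq_charFun, mul_neg, charFun_neg]

theorem memLp_fourierChar (μ : Measure ℝ) [IsFiniteMeasure μ] (t : ℝ) (p : ℝ≥0∞) :
    MemLp (fun x : ℝ => (𝐞 (t * x) : ℂ)) p μ :=
  MemLp.of_bound (by fun_prop) 1 (Eventually.of_forall fun x => (Circle.norm_coe _).le)

/-- The exponential `x ↦ e^{2π i t x}` as an element of `L²(μ)`. -/
noncomputable def expLp (μ : Measure ℝ) [IsFiniteMeasure μ] (t : ℝ) : Lp ℂ 2 μ :=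
  (memLp_fourierChar μ t 2).toLp _

theorem coeFn_expLp (μ : Measure ℝ) [IsFiniteMeasure μ] (t : ℝ) :
    expLp μ t =ᵐ[μ] fun x => (𝐞 (t * x) : ℂ) :=
  (memLp_fourierChar μ t 2).coeFn_toLp

theorem inner_expLp_left (μ : Measure ℝ) [IsFiniteMeasure μ] (t : ℝ) (f : Lp ℂ 2 μ) :
    inner ℂ (expLp μ t) f = ∫ x, (𝐞 (-(t * x)) : ℂ) * f x ∂μ := by
  rw [L2.inner_def]
  refine integral_congr_ae ?_
  filter_upwards [coeFn_expLp μ t] with x hx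
  rw [hx, RCLike.inner_apply, conj_fourierChar, mul_comm]

theorem inner_expLp (μ : Measure ℝ) [IsFiniteMeasure μ] (s t : ℝ) :
    inner ℂ (expLp μ s) (expLp μ t) = fourierStieltjes μ (t - s) := by
  rw [inner_expLp_left]
  refine integral_congr_ae ?_
  filter_upwards [coeFn_expLp μ t] with x hx
  rw [hx, ← Circle.coe_mul, ← AddChar.map_add_eq_mul]
  ring_nf

theorem norm_expLp (μ : Measure ℝ) [IsProbabilityMeasure μ] (t : ℝ) : ‖expLp μ t‖ = 1 := by
  rw [norm_eq_sqrt_re_inner (𝕜 := ℂ), inner_expLp, sub_self, fourierStieltjes_zero]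
  simp

theorem IsSelfSimilarMeasure.fourierStieltjes_eq {N : ℕ} {B : Finset ℤ} {μ : Measure ℝ}
    (hμ : IsSelfSimilarMeasure N B μ) (t : ℝ) :
    fourierStieltjes μ t = mask B (t / N) * fourierStieltjes μ (t / N) := by
  rw [fourierStieltjes_eq_charFun, charFun_selfSimilar hμ, fourierStieltjes_eq_charFun,
    mask_eq_sum_fourierChar, ← Finset.sum_mul, ← mul_assoc, mul_div_assoc]
  congr 3
  funext b
  rw [Real.fourierChar_apply]
  push_cast
  ring_nf

end Fourier

section Totality

open scoped SchwartzMap ContDiff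

variable {V F : Type*} [NormedAddCommGroup V] [InnerProductSpace ℝ V] [FiniteDimensional ℝ V]
  [MeasurableSpace V] [BorelSpace V] [NormedAddCommGroup F] [NormedSpace ℂ F] [CompleteSpace F]

theorem ae_eq_zero_of_fourierIntegral_eq_zero {μ : Measure V} [SigmaFinite μ] {f : V → F}
    (hf : Integrable f μ) (h : VectorFourier.fourierIntegral 𝐞 μ (innerₗ V) f = 0) :
    f =ᵐ[μ] 0 := by
  refine ae_eq_zero_of_integral_contDiff_smul_eq_zero hf.locallyIntegrable fun g hg hgc => ?_
  -- a test function is the Fourier transform of a Schwartz function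
  let φ : 𝓢(V, ℂ) := (hgc.comp_left Complex.ofReal_zero).toSchwartzMap
    (Complex.ofRealCLM.contDiff.comp hg)
  let ψ : 𝓢(V, ℂ) := 𝓕⁻ φ
  have hgψ : ∀ x, (g x : ℂ) = VectorFourier.fourierIntegral 𝐞 volume (innerₗ V) ψ x := by
    intro x
    have hφ : 𝓕 ψ = φ := FourierTransform.fourier_fourierInv_eq φ
    calc (g x : ℂ) = 𝓕 ψ x := (DFunLike.congr_fun hφ x).symm
      _ = 𝓕 (ψ : V → ℂ) x := by rw [SchwartzMap.fourier_coe]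
  simp_rw [← Complex.coe_smul, hgψ]
  rw [VectorFourier.integral_fourierIntegral_smul_eq_flip Real.continuous_fourierChar
    continuous_inner ψ.integrable hf, flip_innerₗ, h]
  simp

theorem eq_zero_of_inner_expLp_eq_zero {μ : Measure ℝ} [IsFiniteMeasure μ] {f : Lp ℂ 2 μ}
    (h : ∀ t, inner ℂ (expLp μ t) f = 0) : f = 0 := by
  rw [Lp.eq_zero_iff_ae_eq_zero]
  refine ae_eq_zero_of_fourierIntegral_eq_zero ((Lp.memLp f).integrable one_le_two) ?_
  funext t
  rw [Pi.zero_apply, ← h t, inner_expLp_left]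
  rfl

end Totality

section Analyticity

open scoped BoundedContinuousFunction ContDiff

variable {μ : Measure ℝ}

theorem exp_boundedContinuousFunction_apply {X : Type*} [TopologicalSpace X] (f : X →ᵇ ℂ) (x : X) :
    NormedSpace.exp f x = Complex.exp (f x) := by
  let ev : (X →ᵇ ℂ) →ₐ[ℂ] ℂ :=
    (ContinuousMap.evalAlgHom ℂ ℂ x).comp (BoundedContinuousFunction.toContinuousMapₐ ℂ)
  rw [Complex.exp_eq_exp_ℂ]
  exact NormedSpace.map_exp ev (BoundedContinuousFunction.lipschitz_eval_const x).continuous f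

theorem exists_boundedContinuousFunction_ae_eq {R : ℝ} (hR : ∀ᵐ x ∂μ, |x| ≤ R) :
    ∃ f : ℝ →ᵇ ℂ, f =ᵐ[μ] fun x => (x : ℂ) := by
  refine ⟨BoundedContinuousFunction.ofNormedAddCommGroup
    (fun x : ℝ => ((max (-|R|) (min x |R|) : ℝ) : ℂ)) (by fun_prop) |R| fun x => ?_, ?_⟩
  · rw [Complex.norm_real, Real.norm_eq_abs, abs_le]
    exact ⟨le_max_left _ _, max_le (neg_le_self (abs_nonneg R)) (min_le_right _ _)⟩
  · filter_upwards [hR] with x hx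
    have hx' := abs_le.1 (hx.trans (le_abs_self R))
    simp [min_eq_left hx'.2, max_eq_right hx'.1]

theorem contDiff_expLp [IsFiniteMeasure μ] {R : ℝ} (hR : ∀ᵐ x ∂μ, |x| ≤ R) :
    ContDiff ℝ ω (expLp μ) := by
  obtain ⟨f, hf⟩ := exists_boundedContinuousFunction_ae_eq hR
  let T : (ℝ →ᵇ ℂ) →L[ℝ] Lp ℂ 2 μ :=
    (BoundedContinuousFunction.toLp (p := 2) μ ℂ).restrictScalars ℝ
  have hexp : expLp μ =
      fun t : ℝ => T (NormedSpace.exp (t • (2 * Real.pi * Complex.I : ℂ) • f)) := by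
    funext t
    refine Lp.ext ((coeFn_expLp μ t).trans ?_)
    refine EventuallyEq.trans ?_ (BoundedContinuousFunction.coeFn_toLp (p := 2) μ ℂ _).symm
    filter_upwards [hf] with x hx
    rw [exp_boundedContinuousFunction_apply, ← exp_two_pi_I_mul]
    simp [hx]
    ring_nf
  have hana : AnalyticOnNhd ℝ (NormedSpace.exp : (ℝ →ᵇ ℂ) → ℝ →ᵇ ℂ) Set.univ :=
    fun f _ => NormedSpace.exp_analytic (𝕂 := ℝ) f
  rw [hexp]
  exact T.contDiff.comp (hana.contDiff.comp (contDiff_id.smul contDiff_const))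

end Analyticity

section Support

variable {N : ℕ} {B : Finset ℤ} {μ : Measure ℝ}

theorem IsSelfSimilarMeasure.measure_lt_abs_le (hN : 2 ≤ N)
    (hB : B.Nonempty) (hμ : IsSelfSimilarMeasure N B μ) {M : ℝ} (hM : ∀ b ∈ B, |(b : ℝ)| ≤ M)
    {s : ℝ} (hs : 0 ≤ s) : μ {x | M + s < |x|} ≤ μ {x | M + 2 * s < |x|} := by
  have h2 : (2 : ℝ) ≤ N := by exact_mod_cast hN
  have hmap : ∀ b ∈ B, μ.map (tau N b) {x | M + s < |x|} ≤ μ {x | M + 2 * s < |x|} := by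
    intro b hb
    rw [Measure.map_apply (measurable_tau b) (measurableSet_lt (by fun_prop) (by fun_prop))]
    refine measure_mono fun x hx => ?_
    simp only [Set.mem_preimage, Set.mem_ofPred_eq, tau, abs_div, Nat.abs_cast] at hx ⊢
    rw [lt_div_iff₀ (by linarith)] at hx
    nlinarith [abs_add_le x b, hM b hb, abs_nonneg (b : ℝ)]
  conv_lhs => rw [hμ.selfSimilar]
  calc (((B.card : ℝ≥0∞)⁻¹ • ∑ b ∈ B, μ.map (tau N b)) {x | M + s < |x|})
      = (B.card : ℝ≥0∞)⁻¹ * ∑ b ∈ B, μ.map (tau N b) {x | M + s < |x|} := by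
        rw [Measure.smul_apply, Measure.finsetSum_apply, smul_eq_mul]
    _ ≤ (B.card : ℝ≥0∞)⁻¹ * ∑ _ ∈ B, μ {x | M + 2 * s < |x|} := by
        exact mul_le_mul_right (Finset.sum_le_sum hmap) _
    _ = μ {x | M + 2 * s < |x|} := by
        rw [Finset.sum_const, nsmul_eq_mul, ← mul_assoc, ENNReal.inv_mul_cancel
          (Nat.cast_ne_zero.2 hB.card_ne_zero) (ENNReal.natCast_ne_top _), one_mul]

theorem IsSelfSimilarMeasure.exists_ae_abs_le (hN : 2 ≤ N)
    (hB : B.Nonempty) (hμ : IsSelfSimilarMeasure N B μ) : ∃ R, ∀ᵐ x ∂μ, |x| ≤ R := by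
  have := hμ.isProbabilityMeasure
  obtain ⟨M, hM⟩ := exists_digit_bound B
  have hiter : ∀ n : ℕ, μ {x | M + 1 < |x|} ≤ μ {x | M + 2 ^ n < |x|} := by
    intro n
    induction n with
    | zero => simp
    | succ n ih =>
      rw [pow_succ']
      exact ih.trans (hμ.measure_lt_abs_le hN hB hM (by positivity))
  have htight := tendsto_measure_norm_gt_of_isTightMeasureSet
    (isTightMeasureSet_singleton (μ := μ))
  have hlim : Tendsto (fun n : ℕ => μ {x | M + 2 ^ n < |x|}) atTop (𝓝 0) := by
    simpa using! htight.comp (tendsto_atTop_add_const_left _ M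
      (tendsto_pow_atTop_atTop_of_one_lt (one_lt_two (α := ℝ))))
  refine ⟨M + 1, ?_⟩
  rw [ae_iff]
  simpa using ge_of_tendsto' hlim hiter

end Support

section Orthogonality

variable {N : ℕ} {B L : Finset ℤ} {μ : Measure ℝ}

theorem IsHadamardTriple.mask_mul_add_sub_div (h : IsHadamardTriple N B L) {u u' : ℝ}
    (hu : u ∈ intDiv (B.gcd id)) (hu' : u' ∈ intDiv (B.gcd id)) {l l' : ℤ} (hl : l ∈ L)
    (hl' : l' ∈ L) (hne : l ≠ l') : mask B ((N * u + l - (N * u' + l')) / N) = 0 := by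
  have hN : (N : ℝ) ≠ 0 := Nat.cast_ne_zero.2 h.ne_zero
  have hsplit : (N * u + l - (N * u' + l')) / N = ((l : ℝ) - l') / N + (u + -u') := by
    field_simp
    ring
  rw [hsplit, mask_add_of_mem_intDiv h.gcd_ne_zero _ (add_mem_intDiv hu (neg_mem_intDiv hu')),
    h.mask_sub_div hl' hl hne.symm]

theorem IsHadamardTriple.eq_of_mul_add_eq (h : IsHadamardTriple N B L) {u u' : ℝ}
    (hu : u ∈ intDiv (B.gcd id)) (hu' : u' ∈ intDiv (B.gcd id)) {l l' : ℤ} (hl : l ∈ L)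
    (hl' : l' ∈ L) (heq : (N : ℝ) * u + l = N * u' + l') : u = u' ∧ l = l' := by
  have hll' : l = l' := by
    by_contra hne
    simpa [heq, mask_zero h.nonempty] using h.mask_mul_add_sub_div hu hu' hl hl' hne
  subst hll'
  exact ⟨mul_left_cancel₀ (Nat.cast_ne_zero.2 h.ne_zero) (add_right_cancel heq), rfl⟩

theorem IsHadamardTriple.fourierStieltjes_sub_eq_zero_of_abs_lt (h : IsHadamardTriple N B L)
    (hB0 : (0 : ℤ) ∈ B) (hμ : IsSelfSimilarMeasure N B μ) (n : ℕ) {s s' : ℝ}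
    (hs : s ∈ canonicalSpectrum N B L) (hs' : s' ∈ canonicalSpectrum N B L) (hne : s ≠ s')
    (hlt : |((B.gcd id : ℤ) : ℝ) * (s - s')| < (N : ℝ) ^ n) : fourierStieltjes μ (s - s') = 0 := by
  have hd := h.gcd_ne_zero
  have hN : (N : ℝ) ≠ 0 := Nat.cast_ne_zero.2 h.ne_zero
  have hsub := canonicalSpectrum_subset_intDiv (N := N) (L := L) hB0 hd
  induction n generalizing s s' with
  | zero =>
    obtain ⟨k, hk⟩ := (mem_intDiv_iff hd).1 (add_mem_intDiv (hsub hs) (neg_mem_intDiv (hsub hs')))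
    rw [← sub_eq_add_neg] at hk
    rw [hk, pow_zero] at hlt
    have hk0 : k = 0 := Int.abs_lt_one_iff.1 (by exact_mod_cast hlt)
    rw [hk0, Int.cast_zero, mul_eq_zero, Int.cast_eq_zero] at hk
    exact absurd (sub_eq_zero.1 (hk.resolve_left hd)) hne
  | succ n ih =>
    obtain ⟨u, hu, l, hl, rfl⟩ := exists_mul_add_eq_of_mem_canonicalSpectrum h.ne_zero hs
    obtain ⟨u', hu', l', hl', rfl⟩ := exists_mul_add_eq_of_mem_canonicalSpectrum h.ne_zero hs'
    rw [hμ.fourierStieltjes_eq]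
    by_cases hll' : l = l'
    · subst hll'
      have hdiv : (N * u + l - (N * u' + l)) / N = u - u' := by
        field_simp
        ring
      have hscale : ((B.gcd id : ℤ) : ℝ) * (N * u + l - (N * u' + l)) =
          N * (((B.gcd id : ℤ) : ℝ) * (u - u')) := by ring
      rw [hscale, abs_mul, Nat.abs_cast, pow_succ'] at hlt
      rw [hdiv, ih hu hu' (fun huu' => hne (by rw [huu']))
        (lt_of_mul_lt_mul_left hlt N.cast_nonneg), mul_zero]
    · rw [h.mask_mul_add_sub_div (hsub hu) (hsub hu') hl hl' hll', zero_mul]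

theorem IsHadamardTriple.orthonormal_expLp (h : IsHadamardTriple N B L) (hB0 : (0 : ℤ) ∈ B)
    [IsProbabilityMeasure μ] (hμ : IsSelfSimilarMeasure N B μ) :
    Orthonormal ℂ fun s : canonicalSpectrum N B L => expLp μ s := by
  refine ⟨fun s => norm_expLp μ s, fun s s' hne => ?_⟩
  obtain ⟨n, hn⟩ := pow_unbounded_of_one_lt |((B.gcd id : ℤ) : ℝ) * (s' - s)|
    (Nat.one_lt_cast.2 h.two_le : (1 : ℝ) < N)
  rw [inner_expLp]
  exact h.fourierStieltjes_sub_eq_zero_of_abs_lt hB0 hμ n s'.2 s.2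
    (Subtype.coe_injective.ne hne.symm) hn

end Orthogonality

section Analysis

variable {𝕜 ι E : Type*} [RCLike 𝕜] [NormedAddCommGroup E] [InnerProductSpace 𝕜 E]
  [CompleteSpace E] {v : ι → E}

/-- The analysis operator `w ↦ (⟪v i, w⟫)_i` of an orthonormal family, defined as the adjoint of
the isometry `ℓ² → E` that synthesizes a vector from its coefficients. -/
noncomputable def analysisOp (hv : Orthonormal 𝕜 v) : E →L[𝕜] lp (fun _ : ι => 𝕜) 2 :=
  ContinuousLinearMap.adjoint hv.orthogonalFamily.linearIsometry.toContinuousLinearMap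

theorem inner_analysisOp (hv : Orthonormal 𝕜 v) (c : lp (fun _ : ι => 𝕜) 2) (w : E) :
    inner 𝕜 c (analysisOp hv w) = inner 𝕜 (hv.orthogonalFamily.linearIsometry c) w :=
  ContinuousLinearMap.adjoint_inner_right _ _ _

theorem analysisOp_apply (hv : Orthonormal 𝕜 v) (w : E) (i : ι) :
    analysisOp hv w i = inner 𝕜 (v i) w := by
  classical
  have hsingle := lp.inner_single_left (𝕜 := 𝕜) i (1 : 𝕜) (analysisOp hv w)
  rw [inner_analysisOp, OrthogonalFamily.linearIsometry_apply_single] at hsingle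
  simpa using hsingle.symm

theorem hasSum_norm_analysisOp (hv : Orthonormal 𝕜 v) (w : E) :
    HasSum (fun i => ‖inner 𝕜 (v i) w‖ ^ 2) (‖analysisOp hv w‖ ^ 2) := by
  simpa [analysisOp_apply] using lp.hasSum_norm (p := 2) (by simp) (analysisOp hv w)

theorem norm_analysisOp_le (hv : Orthonormal 𝕜 v) (w : E) : ‖analysisOp hv w‖ ≤ ‖w‖ := by
  refine (sq_le_sq₀ (norm_nonneg _) (norm_nonneg _)).1 ?_
  rw [← (hasSum_norm_analysisOp hv w).tsum_eq]
  exact hv.tsum_inner_products_le w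

theorem linearIsometry_analysisOp (hv : Orthonormal 𝕜 v) {w : E} (hw : ‖analysisOp hv w‖ = ‖w‖) :
    hv.orthogonalFamily.linearIsometry (analysisOp hv w) = w := by
  have hsq := norm_sub_sq (𝕜 := 𝕜) (hv.orthogonalFamily.linearIsometry (analysisOp hv w)) w
  rw [← inner_analysisOp hv, inner_self_eq_norm_sq, LinearIsometry.norm_map, hw] at hsq
  rw [← sub_eq_zero, ← norm_eq_zero, ← sq_eq_zero_iff, hsq]
  ring

theorem inner_eq_zero_of_norm_analysisOp (hv : Orthonormal 𝕜 v) {w z : E}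
    (hw : ‖analysisOp hv w‖ = ‖w‖) (hz : ∀ i, inner 𝕜 (v i) z = 0) : inner 𝕜 w z = 0 := by
  have hz0 : analysisOp hv z = 0 := by
    ext i
    rw [analysisOp_apply, hz, lp.coeFn_zero, Pi.zero_apply]
  rw [← linearIsometry_analysisOp hv hw, ← inner_analysisOp hv, hz0, inner_zero_right]

end Analysis

section SpectralSum

variable {μ : Measure ℝ} [IsProbabilityMeasure μ] {Λ : Set ℝ}

/-- The function `x ↦ ∑_{λ ∈ Λ} |μ̂(x + λ)|²`. For orthogonal exponentials it is bounded by `1`, and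
it is identically `1` exactly if they span `L²(μ)` (the Jorgensen–Pedersen criterion). -/
noncomputable def spectralSum (μ : Measure ℝ) (Λ : Set ℝ) (x : ℝ) : ℝ :=
  ∑' s : Λ, ‖fourierStieltjes μ (x + s)‖ ^ 2

theorem hasSum_spectralSum (hv : Orthonormal ℂ fun s : Λ => expLp μ s) (x : ℝ) :
    HasSum (fun s : Λ => ‖fourierStieltjes μ (x + s)‖ ^ 2)
      (‖analysisOp hv (expLp μ (-x))‖ ^ 2) := by
  convert hasSum_norm_analysisOp hv (expLp μ (-x)) using 3 with s
  rw [inner_expLp, ← Complex.norm_conj, ← fourierStieltjes_neg, neg_add']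

theorem spectralSum_eq (hv : Orthonormal ℂ fun s : Λ => expLp μ s) (x : ℝ) :
    spectralSum μ Λ x = ‖analysisOp hv (expLp μ (-x))‖ ^ 2 :=
  (hasSum_spectralSum hv x).tsum_eq

theorem spectralSum_le_one (hv : Orthonormal ℂ fun s : Λ => expLp μ s) (x : ℝ) :
    spectralSum μ Λ x ≤ 1 := by
  rw [spectralSum_eq hv]
  exact pow_le_one₀ (norm_nonneg _) ((norm_analysisOp_le hv _).trans_eq (norm_expLp μ _))

theorem spectralSum_eq_one_of_neg_mem (hv : Orthonormal ℂ fun s : Λ => expLp μ s) {x : ℝ}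
    (hx : -x ∈ Λ) : spectralSum μ Λ x = 1 := by
  refine le_antisymm (spectralSum_le_one hv x) ?_
  have hterm := (hasSum_spectralSum hv x).summable.le_tsum ⟨-x, hx⟩ fun _ _ => by positivity
  simpa [fourierStieltjes_zero] using! hterm

theorem analyticOnNhd_spectralSum (hv : Orthonormal ℂ fun s : Λ => expLp μ s) {R : ℝ}
    (hR : ∀ᵐ x ∂μ, |x| ≤ R) : AnalyticOnNhd ℝ (spectralSum μ Λ) Set.univ := by
  have hcoeff := ((analysisOp hv).restrictScalars ℝ).contDiff.comp
    ((contDiff_expLp hR).comp contDiff_neg)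
  rw [funext (spectralSum_eq hv)]
  exact (hcoeff.norm_sq ℂ).analyticOnNhd

theorem isSpectralPair_of_spectralSum_eq_one (hΛ : Λ.Countable)
    (hv : Orthonormal ℂ fun s : Λ => expLp μ s) (h1 : ∀ x, spectralSum μ Λ x = 1) :
    IsSpectralPair μ Λ := by
  have htight : ∀ t, ‖analysisOp hv (expLp μ t)‖ = ‖expLp μ t‖ := by
    intro t
    have hsq := spectralSum_eq hv (-t)
    rw [h1, neg_neg] at hsq
    rw [norm_expLp]
    exact (pow_eq_one_iff_of_nonneg (norm_nonneg _) two_ne_zero).1 hsq.symm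
  have htotal : (Submodule.span ℂ (Set.range fun s : Λ => expLp μ s))ᗮ = ⊥ := by
    refine (Submodule.eq_bot_iff _).2 fun f hf => eq_zero_of_inner_expLp_eq_zero fun t =>
      inner_eq_zero_of_norm_analysisOp hv (htight t) fun s => ?_
    exact (Submodule.mem_orthogonal _ _).1 hf _ (Submodule.subset_span ⟨s, rfl⟩)
  refine ⟨inferInstance, hΛ, HilbertBasis.mkOfOrthogonalEqBot hv htotal, fun s => ?_⟩
  rw [HilbertBasis.coe_mkOfOrthogonalEqBot]
  filter_upwards [coeFn_expLp μ s] with x hx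
  rw [hx, ← exp_two_pi_I_mul]
  push_cast
  ring_nf

end SpectralSum

section TransferOperator

variable {N : ℕ} {B L : Finset ℤ}

/-- The transfer (Ruelle) operator of the random walk `x ↦ τ_l(x)`, `l ∈ L`, with transition
probabilities `|m_B(τ_l x)|²`. -/
noncomputable def transferOp (N : ℕ) (B L : Finset ℤ) (F : ℝ → ℝ) (x : ℝ) : ℝ :=
  ∑ l ∈ L, ‖mask B (tau N l x)‖ ^ 2 * F (tau N l x)

theorem IsHadamardTriple.bijective_mul_add (h : IsHadamardTriple N B L) (hB0 : (0 : ℤ) ∈ B) :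
    Function.Bijective fun p : canonicalSpectrum N B L × L =>
      (⟨N * (p.1 : ℝ) + (p.2 : ℤ), mul_add_mem_canonicalSpectrum p.1.2 p.2.2⟩ :
        canonicalSpectrum N B L) := by
  have hsub := canonicalSpectrum_subset_intDiv (N := N) (L := L) hB0 h.gcd_ne_zero
  constructor
  · rintro ⟨s, l⟩ ⟨s', l'⟩ heq
    have hinj := h.eq_of_mul_add_eq (hsub s.2) (hsub s'.2) l.2 l'.2 (congrArg Subtype.val heq)
    exact Prod.ext (Subtype.ext hinj.1) (Subtype.ext hinj.2)
  · rintro ⟨s, hs⟩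
    obtain ⟨u, hu, l, hl, hul⟩ := exists_mul_add_eq_of_mem_canonicalSpectrum h.ne_zero hs
    exact ⟨(⟨u, hu⟩, ⟨l, hl⟩), Subtype.ext hul⟩

theorem IsHadamardTriple.norm_fourierStieltjes_add_mul_add_sq (h : IsHadamardTriple N B L)
    {μ : Measure ℝ} (hμ : IsSelfSimilarMeasure N B μ) (x : ℝ) {s : ℝ}
    (hs : s ∈ intDiv (B.gcd id)) (l : ℤ) :
    ‖fourierStieltjes μ (x + (N * s + l))‖ ^ 2 =
      ‖mask B (tau N l x)‖ ^ 2 * ‖fourierStieltjes μ (tau N l x + s)‖ ^ 2 := by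
  have hN : (N : ℝ) ≠ 0 := Nat.cast_ne_zero.2 h.ne_zero
  have hdiv : (x + (N * s + l)) / N = tau N l x + s := by
    rw [tau]
    field_simp
    ring
  rw [hμ.fourierStieltjes_eq, hdiv, mask_add_of_mem_intDiv h.gcd_ne_zero _ hs, norm_mul, mul_pow]

theorem IsHadamardTriple.transferOp_spectralSum (h : IsHadamardTriple N B L)
    (hB0 : (0 : ℤ) ∈ B) {μ : Measure ℝ} [IsProbabilityMeasure μ]
    (hμ : IsSelfSimilarMeasure N B μ) :
    transferOp N B L (spectralSum μ (canonicalSpectrum N B L)) =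
      spectralSum μ (canonicalSpectrum N B L) := by
  funext x
  have hv := h.orthonormal_expLp hB0 hμ
  have hsub := canonicalSpectrum_subset_intDiv (N := N) (L := L) hB0 h.gcd_ne_zero
  have hsum := (hasSum_spectralSum hv x).summable
  let e := Equiv.ofBijective _ (h.bijective_mul_add hB0)
  symm
  calc spectralSum μ (canonicalSpectrum N B L) x
      = ∑' p, ‖fourierStieltjes μ (x + e p)‖ ^ 2 := (e.tsum_eq _).symm
    _ = ∑' s : canonicalSpectrum N B L, ∑ l : L, ‖fourierStieltjes μ (x + e (s, l))‖ ^ 2 := by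
      simpa only [tsum_fintype] using! (e.summable_iff.2 hsum).tsum_prod
    _ = ∑' s : canonicalSpectrum N B L, ∑ l ∈ L,
          ‖mask B (tau N l x)‖ ^ 2 * ‖fourierStieltjes μ (tau N l x + s)‖ ^ 2 := by
      refine tsum_congr fun s => ?_
      rw [← Finset.sum_coe_sort L]
      exact Finset.sum_congr rfl fun l _ =>
        h.norm_fourierStieltjes_add_mul_add_sq hμ x (hsub s.2) l
    _ = transferOp N B L (spectralSum μ (canonicalSpectrum N B L)) x := by
      rw [Summable.tsum_finsetSum fun l _ => (hasSum_spectralSum hv _).summable.mul_left _]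
      exact Finset.sum_congr rfl fun l _ => tsum_mul_left

theorem IsHadamardTriple.eq_of_maskStep (h : IsHadamardTriple N B L) {F : ℝ → ℝ} {x y : ℝ}
    (hx : transferOp N B L F x = F x) (hmin : ∀ l ∈ L, F x ≤ F (tau N l x))
    (hxy : MaskStep N B L x y) : F y = F x := by
  obtain ⟨l, hl, hm, rfl⟩ := hxy
  have hle : ∀ k ∈ L,
      ‖mask B (tau N k x)‖ ^ 2 * F x ≤ ‖mask B (tau N k x)‖ ^ 2 * F (tau N k x) :=
    fun k hk => mul_le_mul_of_nonneg_left (hmin k hk) (sq_nonneg _)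
  have hsum : ∑ k ∈ L, ‖mask B (tau N k x)‖ ^ 2 * F x = transferOp N B L F x := by
    rw [← Finset.sum_mul, h.sum_norm_mask_sq, one_mul, hx]
  have heq := (Finset.sum_eq_sum_iff_of_le hle).1 hsum l hl
  exact (mul_left_cancel₀ (pow_ne_zero 2 (norm_ne_zero_iff.2 hm)) heq).symm

theorem IsHadamardTriple.exists_isExtremeCycle_of_isMinOn (h : IsHadamardTriple N B L)
    {F : ℝ → ℝ} {K : Set ℝ} {z : ℝ} (hfix : ∀ x ∈ K, transferOp N B L F x = F x)
    (hK : ∀ l ∈ L, Set.MapsTo (tau N l) K K) (hz : z ∈ K) (hmin : IsMinOn F K z)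
    (hfin : {x ∈ K | F x = F z}.Finite) :
    ∃ C, IsExtremeCycle N B L C ∧ ∀ x ∈ C, F x = F z := by
  obtain ⟨C, hCE, hC⟩ := h.exists_isExtremeCycle_subset hfin ⟨z, hz, rfl⟩ <| by
    rintro x ⟨hx, hxz⟩ y hxy
    have hyx : F y = F x := h.eq_of_maskStep (hfix x hx)
      (fun l hl => hxz.trans_le (hmin (hK l hl hx))) hxy
    obtain ⟨l, hl, -, rfl⟩ := hxy
    exact ⟨hK l hl hx, hyx.trans hxz⟩
  exact ⟨C, hC, fun x hx => (hCE hx).2⟩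

theorem mapsTo_tau_Icc (hN : 2 ≤ N) {l : ℤ} {M : ℝ} (hl : |(l : ℝ)| ≤ M) :
    Set.MapsTo (tau N l) (Set.Icc (-M) M) (Set.Icc (-M) M) := by
  intro x hx
  have hM : 0 ≤ M := (abs_nonneg _).trans hl
  have hN2 : (2 : ℝ) ≤ N := by exact_mod_cast hN
  rw [Set.mem_Icc, ← abs_le] at hx ⊢
  rw [tau, abs_div, Nat.abs_cast, div_le_iff₀ (by linarith)]
  calc |x + l| ≤ M + M := (abs_add_le x l).trans (add_le_add hx hl)
    _ = M * 2 := (mul_two M).symm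
    _ ≤ M * N := mul_le_mul_of_nonneg_left hN2 hM

theorem eq_const_of_infinite_of_analyticOnNhd {𝕜 E : Type*} [NontriviallyNormedField 𝕜]
    [ConnectedSpace 𝕜] [NormedAddCommGroup E] [NormedSpace 𝕜 E] {f : 𝕜 → E}
    (hf : AnalyticOnNhd 𝕜 f Set.univ) {K : Set 𝕜} (hK : IsCompact K) {c : E}
    (hinf : {x ∈ K | f x = c}.Infinite) (x : 𝕜) : f x = c := by
  obtain ⟨z, -, hz⟩ := hinf.exists_accPt_of_subset_isCompact hK (Set.sep_subset _ _)
  have hfreq : ∃ᶠ y in 𝓝[≠] z, f y = (fun _ => c) y :=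
    (accPt_iff_frequently_nhdsNE.1 hz).mono fun y hy => hy.2
  exact congrFun (hf.eq_of_frequently_eq (fun _ _ => analyticAt_const) hfreq) x

/-- The set of minimizers of `F` on a large interval is closed under the random walk. If it is
finite it contains an extreme cycle, and otherwise `F` is constant by analyticity. -/
theorem IsHadamardTriple.eq_const_of_transferOp_eq (h : IsHadamardTriple N B L)
    (hL0 : (0 : ℤ) ∈ L) {F : ℝ → ℝ} (hF : AnalyticOnNhd ℝ F Set.univ)
    (hfix : transferOp N B L F = F) {c : ℝ} (hle : ∀ x, F x ≤ c)
    (hcycle : ∀ C, IsExtremeCycle N B L C → ∀ x ∈ C, F x = c) (x : ℝ) : F x = c := by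
  obtain ⟨M, hM⟩ := exists_digit_bound L
  have hK (l) (hl : l ∈ L) := mapsTo_tau_Icc h.two_le ((hM l hl).trans (le_max_left M 1))
  have hM0 : -max M 1 < max M 1 := neg_lt_self (zero_lt_one.trans_le (le_max_right M 1))
  obtain ⟨z, hz, hzmin⟩ := isCompact_Icc.exists_isMinOn (Set.nonempty_Icc.2 hM0.le)
    (hF.continuousOn.mono (Set.subset_univ _))
  have hzc : F z = c := by
    by_cases hfin : {y ∈ Set.Icc (-max M 1) (max M 1) | F y = F z}.Finite
    · obtain ⟨C, hC, hCz⟩ :=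
        h.exists_isExtremeCycle_of_isMinOn (fun y _ => congrFun hfix y) hK hz hzmin hfin
      obtain ⟨y, hy⟩ := (isExtremeCycle_iff.1 hC).1.nonempty
      rw [← hCz y hy, hcycle C hC y hy]
    · rw [← eq_const_of_infinite_of_analyticOnNhd hF isCompact_Icc hfin 0]
      exact hcycle {0} (isExtremeCycle_zero h.nonempty hL0) 0 rfl
  refine eq_const_of_infinite_of_analyticOnNhd hF (isCompact_Icc (a := -max M 1) (b := max M 1))
    ((Set.Icc_infinite hM0).mono fun y hy => ⟨hy, ?_⟩) x
  exact (hle y).antisymm (hzc.symm.trans_le (hzmin hy))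

theorem IsHadamardTriple.isSpectralPair (h : IsHadamardTriple N B L) (hB0 : (0 : ℤ) ∈ B)
    (hL0 : (0 : ℤ) ∈ L) : IsSpectralPair (selfSimilarMeasure N B) (canonicalSpectrum N B L) := by
  have hμ := isSelfSimilarMeasure_selfSimilarMeasure h.two_le h.nonempty
  have := hμ.isProbabilityMeasure
  have hv := h.orthonormal_expLp hB0 hμ
  obtain ⟨R, hR⟩ := hμ.exists_ae_abs_le h.two_le h.nonempty
  have hcountable : (canonicalSpectrum N B L).Countable :=
    (Set.countable_range _).mono (canonicalSpectrum_subset_intDiv hB0 h.gcd_ne_zero)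
  refine isSpectralPair_of_spectralSum_eq_one hcountable hv ?_
  exact h.eq_const_of_transferOp_eq hL0 (analyticOnNhd_spectralSum hv hR)
    (h.transferOp_spectralSum hB0 hμ) (spectralSum_le_one hv)
    fun C hC x hx => spectralSum_eq_one_of_neg_mem hv (neg_mem_canonicalSpectrum hC hx)

end TransferOperator

section Maximality

theorem surjective_of_hilbertBasis_eq_comp {𝕜 ι κ E : Type*} [RCLike 𝕜] [NormedAddCommGroup E]
    [InnerProductSpace 𝕜 E] (e : HilbertBasis ι 𝕜 E) {f : κ → E} (hf : Orthonormal 𝕜 f)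
    {g : ι → κ} (hef : ∀ i, e i = f (g i)) : Function.Surjective g := by
  intro j
  by_contra hj
  have hzero : e.repr (f j) = 0 := by
    ext i
    rw [e.repr_apply_apply, hef, hf.inner_eq_zero fun hij => hj ⟨i, hij⟩, lp.coeFn_zero,
      Pi.zero_apply]
  exact hf.ne_zero j ((map_eq_zero_iff _ e.repr.injective).1 hzero)

theorem IsSpectralPair.eq_of_subset {μ : Measure ℝ} {Γ Λ : Set ℝ} (hΓ : IsSpectralPair μ Γ)
    (hΛ : IsSpectralPair μ Λ) (hsub : Γ ⊆ Λ) : Γ = Λ := by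
  obtain ⟨e, he⟩ := hΓ.exists_basis
  obtain ⟨f, hf⟩ := hΛ.exists_basis
  have hef : ∀ s : Γ, e s = f (Set.inclusion hsub s) := fun s =>
    Lp.ext ((he s).trans (hf (Set.inclusion hsub s)).symm)
  exact Set.eq_of_inclusion_surjective (surjective_of_hilbertBasis_eq_comp e f.orthonormal hef)

theorem IsHadamardTriple.isSpectralEigenvalue_iff {N : ℕ} {B L : Finset ℤ}
    (h : IsHadamardTriple N B L) (hB0 : (0 : ℤ) ∈ B) (hL0 : (0 : ℤ) ∈ L) {q : ℤ} (hq : q ≠ 0)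
    (hqN : IsCoprime q (N : ℤ)) :
    IsSpectralEigenvalue (selfSimilarMeasure N B) (canonicalSpectrum N B L) q ↔
      canonicalSpectrum N B (L.image (q * ·)) = (q : ℝ) • canonicalSpectrum N B L := by
  have hpair := (h.image_mul hq hqN).isSpectralPair hB0
    (Finset.mem_image.2 ⟨0, hL0, mul_zero q⟩)
  constructor
  · rintro ⟨-, hpair'⟩
    exact (hpair'.eq_of_subset hpair (smul_canonicalSpectrum_subset hB0 h.gcd_ne_zero)).symm
  · intro heq
    exact ⟨h.isSpectralPair hB0 hL0, by rwa [heq] at hpair⟩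

end Maximality

end CanonicalSpectrum

open CanonicalSpectrum in
theorem proposition3p1_general (N : ℕ) (B L : Finset ℤ) (hH : IsHadamardTriple N B L)
    (hB0 : (0 : ℤ) ∈ B) (hL0 : (0 : ℤ) ∈ L) (q : ℤ) (hqN : IsCoprime q (N : ℤ)) :
    IsSpectralEigenvalue (selfSimilarMeasure N B) (canonicalSpectrum N B L) (q : ℝ) ↔
      attractor N L ∩ intDiv (q * B.gcd id) = attractor N L ∩ intDiv (B.gcd id) := by
  have hq : q ≠ 0 := by
    rintro rfl
    have hN : N = 1 := by simpa [Int.isUnit_iff_natAbs_eq] using isCoprime_zero_left.1 hqN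
    exact absurd hH.two_le (by omega)
  rw [hH.isSpectralEigenvalue_iff hB0 hL0 hq hqN]
  exact canonicalSpectrum_image_mul_eq_iff hH.two_le hB0 hH.gcd_ne_zero hq hqN

theorem proposition3p1 (N : ℕ) (B L : Finset ℤ)
    (hH : CanonicalSpectrum.IsHadamardTriple N B L)
    (hB0 : (0 : ℤ) ∈ B) (hL0 : (0 : ℤ) ∈ L) (hBN : B.card < N)
    (q : ℕ) (hq : 2 ≤ q) (hqN : Nat.gcd q N = 1) :
    CanonicalSpectrum.IsSpectralEigenvalue (CanonicalSpectrum.selfSimilarMeasure N B)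
        (CanonicalSpectrum.canonicalSpectrum N B L) (q : ℝ) ↔
      CanonicalSpectrum.attractor N L ∩ CanonicalSpectrum.intDiv ((q : ℤ) * B.gcd id) =
        CanonicalSpectrum.attractor N L ∩ CanonicalSpectrum.intDiv (B.gcd id) := by
  simpa only [Int.cast_natCast] using
    proposition3p1_general N B L hH hB0 hL0 q (Nat.isCoprime_iff_coprime.2 hqN)
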